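/- Let $F_g$ be the free group of rank $g$, and let $T$ and $T'$ be two trivalent (3-regular) simplicial trees, each endowed with a free, properly discontinuous and cocompact simplicial action of $F_g$, denoted $\rho$ and $\rho'$ respectively. The orbit maps of the two actions identify both Gromov boundaries $\partial T$ and $\partial T'$ with the boundary of $F_g$, and hence with each other: $\xi\in\partial T$ corresponds to $\xi'\in\partial T'$ if and only if there is a sequence $(\gamma_n)$ in $F_g$ with $\rho_{\gamma_n}(v)\to\xi$ and $\rho'_{\gamma_n}(v')\to\xi'$ for all vertices $v$ of $T$ and $v'$ of $T'$. Each edge $e$ of $T$ or of $T'$ induces a partition $P_e=\{e^+,e^-\}$ of this common boundary space, where $e^{+}$ and $e^-$ are the boundaries of the two components of the tree minus the open edge $e$. Two such partitions $P_e$ and $P_{e'}$ are called non-nested if all four sets $e^{\pm}\cap e'^{\pm}$ are non-empty. Assume that no edge of $T$ induces the same partition as an edge of $T'$. Let the core $C(T,T')\subseteq T\times T'$ be the union of all closed squares $e\times e'$, where $e$ is an edge of $T$ and $e'$ an edge of $T'$ such that $P_e$ and $P_{e'}$ are non-nested, and let $\Delta(T,T')$ be the quotient of $C(T,T')$ by the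 diagonal action of $F_g$. Then $C(T,T')$ is simply connected, and the fundamental group of $\Delta(T,T')$ is isomorphic to $F_g$. -/

import Mathlib

open Filter

namespace TreeCore

section Boundary

variable {V : Type*}

/-- A geodesic ray in a graph: `edist` is the path distance, with value `⊤` between different
components. -/
structure GeodesicRay (G : SimpleGraph V) where
  toFun : ℕ → V
  geodesic : ∀ m k : ℕ, G.edist (toFun m) (toFun (m + k)) = k

/-- Two geodesic rays are asymptotic if they stay at bounded distance from each other. -/
def asymptotic (G : SimpleGraph V) : Setoid (GeodesicRay G) where
  r r s := ∃ K : ℕ, ∀ n, G.edist (r.toFun n) (s.toFun n) ≤ K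
  iseqv :=
    { refl := fun r => ⟨0, fun n => by simp⟩
      symm := fun ⟨K, h⟩ => ⟨K, fun n => by rw [SimpleGraph.edist_comm]; exact h n⟩
      trans := fun ⟨K, h⟩ ⟨L, h'⟩ => ⟨K + L, fun n => by
        push_cast
        exact SimpleGraph.edist_triangle.trans (add_le_add (h n) (h' n))⟩ }

/-- The Gromov boundary `∂T`: geodesic rays up to bounded distance. -/
def GromovBoundary (T : SimpleGraph V) : Type _ := Quotient (asymptotic T)

/-- For an oriented edge `d`, the set of vertices of the component of `T` minus the open edge `d`
that contains the terminal vertex of `d`. -/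
def halfTree (T : SimpleGraph V) (d : T.Dart) : Set V :=
  {w | (T.deleteEdges {d.edge}).Reachable d.snd w}

/-- The boundary of the half-tree of `d`: the points of `∂T` represented by a ray that eventually
stays in the half-tree. For the two orientations of an edge `e` these are `e⁺` and `e⁻`. -/
def side (T : SimpleGraph V) (d : T.Dart) : Set (GromovBoundary T) :=
  {ξ | ∃ r : GeodesicRay T, (Quotient.mk (asymptotic T) r : GromovBoundary T) = ξ ∧
    ∀ᶠ n in atTop, r.toFun n ∈ halfTree T d}

/-- The partition `P_e = {e⁺, e⁻}` of `∂T` induced by an edge `e`. -/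
def edgePartition (T : SimpleGraph V) (e : Sym2 V) : Set (Set (GromovBoundary T)) :=
  {A | ∃ d : T.Dart, d.edge = e ∧ A = side T d}

/-- Convergence of a sequence of vertices to a boundary point, in the topology of `T ∪ ∂T` in
which the half-trees containing `ξ` in their boundary give a neighbourhood basis of `ξ`. -/
def ConvergesTo (T : SimpleGraph V) (w : ℕ → V) (ξ : GromovBoundary T) : Prop :=
  ∀ d : T.Dart, ξ ∈ side T d → ∀ᶠ n in atTop, w n ∈ halfTree T d

/-- Two partitions are non-nested if every set of the one meets every set of the other. -/
def NonNested {B : Type*} (P Q : Set (Set B)) : Prop :=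
  ∀ A ∈ P, ∀ A' ∈ Q, (A ∩ A').Nonempty

/-- Every vertex has exactly three neighbours. -/
def Trivalent (T : SimpleGraph V) : Prop := ∀ v, (T.neighborSet v).ncard = 3

/-- A free, properly discontinuous and cocompact simplicial action, in terms of vertices.
(A torsion-free group that acts freely on the vertices also acts freely on the geometric
realization, since the square of an element inverting an edge fixes its end points.) -/
structure IsGeometricAction {Γ : Type*} [Group Γ] {T : SimpleGraph V} (ρ : Γ →* (T ≃g T)) :
    Prop where
  free : ∀ γ v, ρ γ v = v → γ = 1
  properlyDiscontinuous : ∀ u v, {γ | ρ γ u = v}.Finite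
  cocompact : ∃ s : Set V, s.Finite ∧ ∀ v, ∃ γ, ∃ u ∈ s, ρ γ u = v

end Boundary

section Core

variable {V V' : Type*} {Γ : Type*} [Group Γ] {T : SimpleGraph V} {T' : SimpleGraph V'}

/-- The canonical identification `∂T ≅ ∂Γ ≅ ∂T'` given by the orbit maps of two geometric actions,
as a relation: `ξ ∈ ∂T` and `ξ' ∈ ∂T'` are identified if some sequence `γ n` in `Γ` satisfies
`γ n • v → ξ` and `γ n • v' → ξ'` for all base vertices `v`, `v'`. -/
def Identified (ρ : Γ →* (T ≃g T)) (ρ' : Γ →* (T' ≃g T'))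
    (ξ : GromovBoundary T) (ξ' : GromovBoundary T') : Prop :=
  ∃ γ : ℕ → Γ, (∀ v, ConvergesTo T (fun n => ρ (γ n) v) ξ) ∧
    (∀ v', ConvergesTo T' (fun n => ρ' (γ n) v') ξ')

/-- The subset of `∂T` corresponding to a subset of `∂T'` under the identification. -/
def transport (ρ : Γ →* (T ≃g T)) (ρ' : Γ →* (T' ≃g T')) (A' : Set (GromovBoundary T')) :
    Set (GromovBoundary T) :=
  {ξ | ∃ ξ' ∈ A', Identified ρ ρ' ξ ξ'}

/-- The partition that an edge of `T'` induces on the boundary space, which is taken to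
be `∂T`. -/
def edgePartition' (ρ : Γ →* (T ≃g T)) (ρ' : Γ →* (T' ≃g T')) (e' : Sym2 V') :
    Set (Set (GromovBoundary T)) :=
  transport ρ ρ' '' edgePartition T' e'

open Classical in
/-- The closed edge (or vertex, if degenerate) spanned by the end points of `e`, in barycentric
coordinates. -/
def closedEdge (e : Sym2 V) : Set (V → ℝ) :=
  convexHull ℝ ((fun v => Pi.single v (1 : ℝ)) '' {v | v ∈ e})

/-- The geometric realization of a graph in barycentric coordinates: the union of its vertices and
closed edges. For a locally finite graph the topology of pointwise convergence on it is the usual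
(CW or path metric) topology. -/
def realization (T : SimpleGraph V) : Set (V → ℝ) :=
  (⋃ v : V, closedEdge s(v, v)) ∪ ⋃ e ∈ T.edgeSet, closedEdge e

/-- The core `C(T,T')`: the union of the closed squares `e × e'` with `P_e` and `P_{e'}`
non-nested. -/
def core (ρ : Γ →* (T ≃g T)) (ρ' : Γ →* (T' ≃g T')) : Set ((V → ℝ) × (V' → ℝ)) :=
  {p | ∃ e ∈ T.edgeSet, ∃ e' ∈ T'.edgeSet,
    NonNested (edgePartition T e) (edgePartition' ρ ρ' e') ∧
      p.1 ∈ closedEdge e ∧ p.2 ∈ closedEdge e'}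

/-- The core is a subset of the product of the two (geometrically realized) trees. -/
theorem core_subset (ρ : Γ →* (T ≃g T)) (ρ' : Γ →* (T' ≃g T')) :
    core ρ ρ' ⊆ realization T ×ˢ realization T' := by
  rintro p ⟨e, he, e', he', -, h, h'⟩
  exact ⟨Or.inr (Set.mem_biUnion he h), Or.inr (Set.mem_biUnion he' h')⟩

/-- The affine extension of a simplicial action to barycentric coordinates; it sends the vertex
`v` to `ρ γ v`. -/
def act (ρ : Γ →* (T ≃g T)) (γ : Γ) (x : V → ℝ) : V → ℝ := fun v => x (ρ γ⁻¹ v)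

/-- The orbit relation of the diagonal action of `Γ` on the core. -/
def coreOrbitRel (ρ : Γ →* (T ≃g T)) (ρ' : Γ →* (T' ≃g T')) : Setoid (core ρ ρ') where
  r p q := ∃ γ : Γ, q.1 = (act ρ γ p.1.1, act ρ' γ p.1.2)
  iseqv :=
    { refl := fun p => ⟨1, by ext v <;> simp [act]⟩
      symm := by
        rintro p q ⟨γ, h⟩
        refine ⟨γ⁻¹, ?_⟩
        rw [h]
        ext v <;> simp [act]
      trans := by
        rintro p q r ⟨γ, h⟩ ⟨δ, h'⟩
        refine ⟨δ * γ, ?_⟩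
        rw [h', h]
        ext v <;> simp [act] }

/-- The quotient `Δ(T,T')` of the core by the diagonal action, with the quotient topology. -/
abbrev Delta (ρ : Γ →* (T ≃g T)) (ρ' : Γ →* (T' ≃g T')) : Type _ := Quotient (coreOrbitRel ρ ρ')

end Core

end TreeCore

/-! The core is a tree of finite trees over `T`. A section `c` of the orbit map of `ρ'` gives a
coarse map `f u = ρ (c u) v₀` from `T'` to `T`. Two sides `e^±`, `e'^±` intersect in the common
boundary exactly when infinitely many vertices of one half-tree of `T'` are sent into the other
half-tree of `T` (`Meets`), by compactness of tree compactifications. So non-nestedness becomes the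
combinatorial relation `Crosses` (`nonNested_iff`), and boundaries can be forgotten.

Over the interior of an edge `e` the fibre of the core is spanned by the edges of `T'` crossing `e`;
over a vertex `v` it is the union of the three adjacent edge fibres. Each of these is a finite
nonempty subtree of `T'`. Convexity holds because crossing means that both half-trees have a
property inherited by larger half-trees; for vertex fibres this uses trivalence
(`exists_crosses_iff`). Finiteness holds because the preimage of a half-tree under `f` has finite
coboundary. Nonemptiness is where distinctness of the partitions enters (`edgeFiber_nonempty`).

Over a finite subtree of `T` the core is contractible, by removing leaves: shrink the fibre over a
leaf to the fibre of its edge, then collapse the resulting product onto the other end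
(`contractibleSpace_coreOver`). A compact set lies over some ball, so the whole core is simply
connected. The diagonal action is a covering action, because the free group is torsion-free and acts
freely on the vertices of `T`; hence the quotient has fundamental group `F_g`. -/

namespace TreeCore

/-! ### Half-trees and distances in a tree. -/

section TreeMetric

variable {V : Type*} {T : SimpleGraph V}

theorem snd_mem_halfTree (d : T.Dart) : d.snd ∈ halfTree T d :=
  SimpleGraph.Reachable.refl _

theorem fst_notMem_halfTree (hT : T.IsTree) (d : T.Dart) : d.fst ∉ halfTree T d := by
  have h := SimpleGraph.isAcyclic_iff_forall_adj_isBridge.1 hT.isAcyclic d.adj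
  rw [SimpleGraph.isBridge_iff] at h
  exact fun hmem => h (SimpleGraph.Reachable.symm hmem)

/-- The only edge leaving a half-tree is the one that defines it. -/
theorem eq_of_adj_of_mem_of_notMem {d : T.Dart} {x y : V} (h : T.Adj x y)
    (hx : x ∈ halfTree T d) (hy : y ∉ halfTree T d) : s(x, y) = d.edge := by
  by_contra hne
  refine hy (SimpleGraph.Reachable.trans hx (SimpleGraph.Adj.reachable ?_))
  rw [SimpleGraph.deleteEdges_adj]
  exact ⟨h, hne⟩

theorem eq_snd_of_adj_of_mem_of_notMem (hT : T.IsTree) {d : T.Dart} {x y : V} (h : T.Adj x y)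
    (hx : x ∈ halfTree T d) (hy : y ∉ halfTree T d) : x = d.snd ∧ y = d.fst := by
  have h' := eq_of_adj_of_mem_of_notMem h hx hy
  have hd : d.edge = s(d.fst, d.snd) := rfl
  rw [hd, Sym2.eq_iff] at h'
  rcases h' with ⟨rfl, rfl⟩ | h'
  · exact absurd hx (fst_notMem_halfTree hT d)
  · exact h'

theorem halfTree_symm (hT : T.IsTree) (d : T.Dart) :
    halfTree T d.symm = (halfTree T d)ᶜ := by
  have he : d.symm.edge = d.edge := d.edge_symm
  ext w
  constructor
  · intro hw hw'
    refine fst_notMem_halfTree hT d (SimpleGraph.Reachable.trans hw' ?_)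
    have h : (T.deleteEdges {d.symm.edge}).Reachable d.fst w := hw
    rw [he] at h
    exact h.symm
  -- A walk cannot leave the union of the two half-trees: the only edge out of either is `d`, which
  -- leads into the other.
  · have key : ∀ {x w : V} (p : T.Walk x w), x ∈ halfTree T d ∨ x ∈ halfTree T d.symm →
        w ∈ halfTree T d ∨ w ∈ halfTree T d.symm := by
      intro x w p
      induction p with
      | nil => exact id
      | @cons a b c hab p ih =>
        intro ha
        apply ih
        by_contra hb
        push Not at hb
        rcases ha with ha | ha
        · obtain ⟨-, rfl⟩ := eq_snd_of_adj_of_mem_of_notMem hT hab ha hb.1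
          exact hb.2 (snd_mem_halfTree d.symm)
        · obtain ⟨-, rfl⟩ := eq_snd_of_adj_of_mem_of_notMem hT hab ha hb.2
          exact hb.1 (snd_mem_halfTree d)
    intro hw
    obtain ⟨p⟩ := hT.connected.preconnected d.snd w
    exact (key p (Or.inl (snd_mem_halfTree d))).resolve_left hw

theorem mem_halfTree_symm (hT : T.IsTree) {d : T.Dart} {w : V} :
    w ∈ halfTree T d.symm ↔ w ∉ halfTree T d := by
  rw [halfTree_symm hT]; rfl

/-- Paths between the two sides of an edge cross the edge. -/
theorem dist_eq_of_mem_of_notMem (hT : T.IsTree) {d : T.Dart} {a b : V}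
    (ha : a ∈ halfTree T d) (hb : b ∉ halfTree T d) :
    T.dist a b = T.dist a d.snd + 1 + T.dist d.fst b := by
  have hc := hT.connected
  apply le_antisymm
  · have h1 := hc.dist_triangle (u := a) (v := d.snd) (w := b)
    have h2 := hc.dist_triangle (u := d.snd) (v := d.fst) (w := b)
    have h3 : T.dist d.snd d.fst = 1 := SimpleGraph.dist_eq_one_iff_adj.2 d.adj.symm
    lia
  · have key : ∀ {a b : V} (p : T.Walk a b), a ∈ halfTree T d → b ∉ halfTree T d →
        T.dist a d.snd + 1 + T.dist d.fst b ≤ p.length := by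
      intro a b p
      induction p with
      | nil => exact fun h h' => absurd h h'
      | @cons x y z hxy p ih =>
        intro hx hz
        rw [SimpleGraph.Walk.length_cons]
        by_cases hy : y ∈ halfTree T d
        · have h1 := ih hy hz
          have h2 := hc.dist_triangle (u := x) (v := y) (w := d.snd)
          have h3 : T.dist x y = 1 := SimpleGraph.dist_eq_one_iff_adj.2 hxy
          lia
        · obtain ⟨rfl, rfl⟩ := eq_snd_of_adj_of_mem_of_notMem hT hxy hx hy
          have := SimpleGraph.dist_le p
          simp only [SimpleGraph.dist_self]
          lia
    obtain ⟨p, hp⟩ := hc.exists_walk_length_eq_dist a b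
    rw [← hp]
    exact key p ha hb

theorem dist_fst_of_mem (hT : T.IsTree) {d : T.Dart} {w : V} (hw : w ∈ halfTree T d) :
    T.dist d.fst w = T.dist d.snd w + 1 := by
  have h := dist_eq_of_mem_of_notMem hT hw (fst_notMem_halfTree hT d)
  rw [SimpleGraph.dist_self] at h
  rw [SimpleGraph.dist_comm, h, SimpleGraph.dist_comm]

theorem dist_snd_of_notMem (hT : T.IsTree) {d : T.Dart} {w : V} (hw : w ∉ halfTree T d) :
    T.dist d.snd w = T.dist d.fst w + 1 :=
  dist_fst_of_mem (d := d.symm) hT ((mem_halfTree_symm hT).2 hw)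

/-- This metric description replaces reachability later: it is visibly invariant under automorphisms
and can be followed along a ray. -/
theorem mem_halfTree_iff (hT : T.IsTree) {d : T.Dart} {w : V} :
    w ∈ halfTree T d ↔ T.dist d.snd w < T.dist d.fst w := by
  constructor
  · intro h; rw [dist_fst_of_mem hT h]; lia
  · intro h
    by_contra h'
    have := dist_snd_of_notMem hT h'
    lia

/-- Half-trees in different directions at a vertex are disjoint. -/
theorem notMem_halfTree_of_ne (hT : T.IsTree) {d d' : T.Dart} (h : d.fst = d'.fst)
    (hne : d.snd ≠ d'.snd) {w : V} (hw : w ∈ halfTree T d) : w ∉ halfTree T d' := by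
  intro hw'
  have h1 : d'.snd ∉ halfTree T d := by
    intro h'
    have := eq_snd_of_adj_of_mem_of_notMem hT (d := d) (x := d'.snd) (y := d'.fst) d'.adj.symm h'
      (h ▸ fst_notMem_halfTree hT d)
    exact hne this.1.symm
  have h2 := dist_eq_of_mem_of_notMem hT hw h1
  have h3 := dist_fst_of_mem hT hw
  have h4 := dist_fst_of_mem hT hw'
  have h5 : T.dist d.fst d'.snd = 1 := by
    rw [h]; exact SimpleGraph.dist_eq_one_iff_adj.2 d'.adj
  rw [h] at h3
  rw [T.dist_comm (u := w) (v := d'.snd), T.dist_comm (u := w) (v := d.snd)] at h2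
  lia

/-- A neighbour of `u` closer to `o` is unique. -/
theorem eq_of_adj_of_dist_lt (hT : T.IsTree) {o u a b : V} (ha : T.Adj u a) (hb : T.Adj u b)
    (hao : T.dist a o < T.dist u o) (hbo : T.dist b o < T.dist u o) : a = b := by
  by_contra hne
  exact notMem_halfTree_of_ne hT (d := ⟨(u, a), ha⟩) (d' := ⟨(u, b), hb⟩) rfl hne
    ((mem_halfTree_iff hT).2 hao) ((mem_halfTree_iff hT).2 hbo)

theorem exists_adj_dist_lt (hT : T.IsTree) {o u : V} (h : u ≠ o) :
    ∃ p, T.Adj u p ∧ T.dist u o = T.dist p o + 1 := by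
  obtain ⟨w, hw⟩ := hT.connected.exists_walk_length_eq_dist u o
  cases w with
  | nil => exact absurd rfl h
  | @cons _ p _ hup w =>
    refine ⟨p, hup, le_antisymm ?_ ?_⟩
    · have h1 := hT.connected.dist_triangle (u := u) (v := p) (w := o)
      have h2 : T.dist u p = 1 := SimpleGraph.dist_eq_one_iff_adj.2 hup
      lia
    · rw [← hw, SimpleGraph.Walk.length_cons]
      have := SimpleGraph.dist_le w
      lia

theorem dist_adj (hT : T.IsTree) (o : V) {u w : V} (h : T.Adj u w) :
    T.dist u o = T.dist w o + 1 ∨ T.dist w o = T.dist u o + 1 := by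
  have := hT.dist_eq_dist_add_one_of_adj o h
  rw [T.dist_comm (u := u), T.dist_comm (u := w)]
  exact this

theorem finite_ball (hT : T.IsTree) (hf : ∀ v, (T.neighborSet v).Finite) (o : V) (n : ℕ) :
    {u | T.dist u o ≤ n}.Finite := by
  induction n with
  | zero =>
    refine (Set.finite_singleton o).subset fun u hu => ?_
    have : T.dist u o = 0 := by simpa using hu
    exact hT.connected.dist_eq_zero_iff.1 this
  | succ n ih =>
    refine (ih.union (ih.biUnion fun v _ => hf v)).subset fun u hu => ?_
    by_cases h : u = o
    · left; simp [h]
    · obtain ⟨p, hp, hd⟩ := exists_adj_dist_lt hT h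
      right
      simp only [Set.mem_ofPred_eq, Set.mem_iUnion] at hu ⊢
      exact ⟨p, by lia, hp.symm⟩

/-- Nested half-trees. -/
theorem halfTree_subset (hT : T.IsTree) {d d' : T.Dart} (h : d'.snd ∈ halfTree T d)
    (h' : d.fst ∉ halfTree T d') : halfTree T d' ⊆ halfTree T d := by
  intro w hw
  by_contra hwd
  have h1 := dist_eq_of_mem_of_notMem hT h hwd
  have h2 := dist_eq_of_mem_of_notMem hT hw h'
  rw [T.dist_comm (u := w) (v := d.fst), T.dist_comm (u := w) (v := d'.snd)] at h2
  lia

end TreeMetric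

/-! ### Convex vertex sets and their leaves. -/

section Convex

variable {V : Type*} {T : SimpleGraph V}

/-- Convexity of a set of vertices of a tree: an edge separating two elements has both its end
points in the set. -/
def TreeConvex (T : SimpleGraph V) (S : Set V) : Prop :=
  ∀ d : T.Dart, (S ∩ halfTree T d).Nonempty → (S ∩ halfTree T d.symm).Nonempty →
    d.fst ∈ S ∧ d.snd ∈ S

theorem treeConvex_singleton (hT : T.IsTree) (o : V) : TreeConvex T {o} := by
  rintro d ⟨a, rfl, ha⟩ ⟨b, rfl, hb⟩
  exact absurd ha ((mem_halfTree_symm hT).1 hb)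

theorem treeConvex_ball (hT : T.IsTree) (o : V) (n : ℕ) : TreeConvex T {u | T.dist u o ≤ n} := by
  rintro d ⟨a, ha, had⟩ ⟨b, hb, hbd⟩
  rw [mem_halfTree_symm hT] at hbd
  have ha' : T.dist a o ≤ n := ha
  have hb' : T.dist b o ≤ n := hb
  change T.dist d.fst o ≤ n ∧ T.dist d.snd o ≤ n
  -- Both ends of `d` lie on the geodesic from `o` to whichever of `a`, `b` is on the other side of
  -- `d`.
  by_cases ho : o ∈ halfTree T d
  · have h1 := dist_eq_of_mem_of_notMem hT ho hbd
    have h2 := dist_fst_of_mem hT ho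
    rw [T.dist_comm (u := o) (v := b), T.dist_comm (u := o) (v := d.snd)] at h1
    lia
  · have h1 := dist_eq_of_mem_of_notMem hT had ho
    have h2 := dist_snd_of_notMem hT ho
    lia

/-- The path from an element of a convex set to another one stays in the set. -/
theorem TreeConvex.mem_of_adj (hT : T.IsTree) {S : Set V} (hS : TreeConvex T S) {o u p : V}
    (ho : o ∈ S) (hu : u ∈ S) (hup : T.Adj u p) (hd : T.dist p o < T.dist u o) : p ∈ S := by
  refine (hS ⟨(u, p), hup⟩ ⟨o, ho, (mem_halfTree_iff hT).2 hd⟩ ⟨u, hu, ?_⟩).2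
  exact snd_mem_halfTree (SimpleGraph.Dart.symm ⟨(u, p), hup⟩)

/-- A finite convex set which is larger than a nonempty convex subset `F` has a leaf outside of
`F`, whose removal leaves a convex set. -/
theorem TreeConvex.exists_leaf (hT : T.IsTree) {S F : Set V} (hS : TreeConvex T S)
    (hfin : S.Finite) (hF : TreeConvex T F) (hne : F.Nonempty) (hFS : F ⊆ S) (hlt : ¬ S ⊆ F) :
    ∃ u ∈ S \ F, ∃ p ∈ S, T.Adj u p ∧ (∀ w ∈ S, T.Adj u w → w = p) ∧ TreeConvex T (S \ {u}) := by
  obtain ⟨o, ho⟩ := hne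
  have hne' : (S \ F).Nonempty := Set.sdiff_nonempty.2 hlt
  -- An element of `S \ F` farthest from a base point of `F` is a leaf: a neighbour farther out
  -- would have to lie in `F`, and convexity of `F` would then put `u` in `F`.
  obtain ⟨u, hu, hmax⟩ := Set.exists_max_image (S \ F) (fun u => T.dist u o)
    (hfin.subset Set.sdiff_subset) hne'
  have huo : u ≠ o := fun h => hu.2 (h ▸ ho)
  obtain ⟨p, hup, hd⟩ := exists_adj_dist_lt hT huo
  have hpS : p ∈ S := hS.mem_of_adj hT (hFS ho) hu.1 hup (by lia)
  have huniq : ∀ w ∈ S, T.Adj u w → w = p := by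
    intro w hw huw
    rcases dist_adj hT o huw with h | h
    · exact eq_of_adj_of_dist_lt hT (o := o) huw hup (by lia) (by lia)
    · exfalso
      by_cases hwF : w ∈ F
      · exact hu.2 (hF.mem_of_adj hT ho hwF huw.symm (by lia))
      · have := hmax w ⟨hw, hwF⟩
        lia
  refine ⟨u, hu, p, hpS, hup, huniq, ?_⟩
  -- If `u` were an end of an edge separating `S \ {u}`, it would have neighbours in `S` on both
  -- sides of that edge, whereas `p` is the only one.
  have key : ∀ d : T.Dart, (S \ {u} ∩ halfTree T d).Nonempty →
      (S \ {u} ∩ halfTree T d.symm).Nonempty → d.snd ≠ u := by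
    rintro d ⟨a, ha, had⟩ ⟨b, hb, hbd⟩ rfl
    have hdS := hS d ⟨a, ha.1, had⟩ ⟨b, hb.1, hbd⟩
    obtain ⟨q, hq, hqd⟩ := exists_adj_dist_lt hT (o := a) (u := d.snd) (fun h => ha.2 h.symm)
    have hqS := hS.mem_of_adj hT ha.1 hu.1 hq (by lia)
    have h1 := huniq q hqS hq
    have h2 := huniq d.fst hdS.1 d.adj.symm
    have h3 := dist_fst_of_mem hT had
    rw [h2, ← h1] at h3
    lia
  intro d hd1 hd2
  have hdS := hS d (hd1.mono (Set.inter_subset_inter_left _ Set.sdiff_subset))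
    (hd2.mono (Set.inter_subset_inter_left _ Set.sdiff_subset))
  exact ⟨⟨hdS.1, key d.symm hd2 (by rwa [SimpleGraph.Dart.symm_symm])⟩, hdS.2, key d hd1 hd2⟩

end Convex

end TreeCore

namespace TreeCore

/-! ### Rays and the sides of an edge in the boundary. -/

section Rays

variable {V : Type*} {T : SimpleGraph V}

theorem GeodesicRay.dist_eq (r : GeodesicRay T) (m k : ℕ) :
    T.dist (r.toFun m) (r.toFun (m + k)) = k := by
  rw [SimpleGraph.dist, r.geodesic]; rfl

theorem GeodesicRay.adj (r : GeodesicRay T) (n : ℕ) : T.Adj (r.toFun n) (r.toFun (n + 1)) :=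
  SimpleGraph.dist_eq_one_iff_adj.1 (r.dist_eq n 1)

/-- A ray eventually moves away from every vertex. -/
theorem GeodesicRay.eventually_dist_succ (hT : T.IsTree) (r : GeodesicRay T) (o : V) :
    ∃ N, ∀ n ≥ N, T.dist (r.toFun (n + 1)) o = T.dist (r.toFun n) o + 1 := by
  have h1 : ∃ N, T.dist (r.toFun (N + 1)) o = T.dist (r.toFun N) o + 1 := by
    by_contra! h
    have h2 : ∀ n, T.dist (r.toFun n) o + n = T.dist (r.toFun 0) o := by
      intro n
      induction n with
      | zero => rfl
      | succ n ih =>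
        rcases dist_adj hT o (r.adj n) with h' | h'
        · lia
        · exact absurd h' (h n)
    have := h2 (T.dist (r.toFun 0) o + 1)
    lia
  obtain ⟨N, hN⟩ := h1
  refine ⟨N, fun n hn => ?_⟩
  induction n, hn using Nat.le_induction with
  | base => exact hN
  | succ n hn ih =>
    rcases dist_adj hT o (r.adj (n + 1)) with h | h
    · exfalso
      have := eq_of_adj_of_dist_lt hT (o := o) (r.adj n).symm (r.adj (n + 1)) (by lia) (by lia)
      have h2 := r.dist_eq n 2
      rw [← this, SimpleGraph.dist_self] at h2
      lia
    · exact h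

/-- The distances to both ends of `d` eventually grow by one at every step, so their comparison no
longer changes. -/
theorem GeodesicRay.eventually_mem_or (hT : T.IsTree) (r : GeodesicRay T) (d : T.Dart) :
    (∀ᶠ n in atTop, r.toFun n ∈ halfTree T d) ∨
      ∀ᶠ n in atTop, r.toFun n ∈ halfTree T d.symm := by
  obtain ⟨N, hN⟩ := r.eventually_dist_succ hT d.fst
  obtain ⟨M, hM⟩ := r.eventually_dist_succ hT d.snd
  have key : ∀ n ≥ max N M, (r.toFun n ∈ halfTree T d ↔ r.toFun (max N M) ∈ halfTree T d) := by
    intro n hn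
    induction n, hn using Nat.le_induction with
    | base => rfl
    | succ n hn ih =>
      rw [← ih, mem_halfTree_iff hT, mem_halfTree_iff hT, T.dist_comm (u := d.snd),
        T.dist_comm (u := d.snd), T.dist_comm (u := d.fst), T.dist_comm (u := d.fst),
        hN n (by lia), hM n (by lia)]
      lia
  by_cases h : r.toFun (max N M) ∈ halfTree T d
  · exact Or.inl (eventually_atTop.2 ⟨_, fun n hn => (key n hn).2 h⟩)
  · exact Or.inr (eventually_atTop.2 ⟨_, fun n hn =>
      (mem_halfTree_symm hT).2 fun h' => h ((key n hn).1 h')⟩)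

/-- Geodesics between rays on opposite sides of `d` run through `d`, while the rays move arbitrarily
far from it; so such rays diverge. -/
theorem eventually_mem_of_asymptotic (hT : T.IsTree) {r s : GeodesicRay T}
    (h : (asymptotic T).r r s) {d : T.Dart} (hr : ∀ᶠ n in atTop, r.toFun n ∈ halfTree T d) :
    ∀ᶠ n in atTop, s.toFun n ∈ halfTree T d := by
  rcases s.eventually_mem_or hT d with hs | hs
  · exact hs
  exfalso
  obtain ⟨K, hK⟩ := h
  obtain ⟨N, hN⟩ := r.eventually_dist_succ hT d.snd
  have h1 : ∀ k, T.dist (r.toFun (N + k)) d.snd = T.dist (r.toFun N) d.snd + k := by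
    intro k
    induction k with
    | zero => rfl
    | succ k ih => rw [← add_assoc, hN _ (by lia), ih]; rfl
  obtain ⟨M, hM⟩ := eventually_atTop.1 (hr.and hs)
  obtain ⟨h2, h3⟩ := hM (N + (M + K)) (by lia)
  have h4 := dist_eq_of_mem_of_notMem hT h2 ((mem_halfTree_symm hT).1 h3)
  have h5 : T.dist (r.toFun (N + (M + K))) (s.toFun (N + (M + K))) ≤ K := by
    have := hK (N + (M + K))
    rw [← (hT.connected.preconnected _ _).coe_dist_eq_edist] at this
    exact_mod_cast this
  rw [h1] at h4
  lia

/-- The boundary point represented by a ray. -/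
def GeodesicRay.endpoint (r : GeodesicRay T) : GromovBoundary T := Quotient.mk (asymptotic T) r

theorem exists_endpoint_eq (ξ : GromovBoundary T) : ∃ r : GeodesicRay T, r.endpoint = ξ :=
  Quotient.exists_rep ξ

theorem endpoint_mem_side (hT : T.IsTree) (r : GeodesicRay T) (d : T.Dart) :
    r.endpoint ∈ side T d ↔
      ∀ᶠ n in atTop, r.toFun n ∈ halfTree T d := by
  constructor
  · rintro ⟨s, hs, h⟩
    exact eventually_mem_of_asymptotic hT (Quotient.exact hs) h
  · exact fun h => ⟨r, rfl, h⟩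

theorem side_symm (hT : T.IsTree) (d : T.Dart) : side T d.symm = (side T d)ᶜ := by
  ext ξ
  obtain ⟨r, rfl⟩ := exists_endpoint_eq ξ
  rw [Set.mem_compl_iff, endpoint_mem_side hT, endpoint_mem_side hT]
  constructor
  · intro h h'
    obtain ⟨n, h1, h2⟩ := (h.and h').exists
    exact (mem_halfTree_symm hT).1 h1 h2
  · exact fun h => (r.eventually_mem_or hT d).resolve_left h

theorem edgePartition_edge (d : T.Dart) :
    edgePartition T d.edge = {side T d, side T d.symm} := by
  ext A
  constructor
  · rintro ⟨d', h, rfl⟩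
    rcases SimpleGraph.dart_edge_eq_iff d' d |>.1 h with rfl | rfl
    · exact Or.inl rfl
    · exact Or.inr rfl
  · rintro (rfl | rfl)
    · exact ⟨d, rfl, rfl⟩
    · exact ⟨d.symm, d.edge_symm, rfl⟩

end Rays

/-! ### Convergence to boundary points and compactness. -/

section Convergence

variable {V : Type*} {T : SimpleGraph V}

/-- A sequence converging to a boundary point leaves every vertex. -/
theorem ConvergesTo.eventually_ne (hT : T.IsTree) {w : ℕ → V} {ξ : GromovBoundary T}
    (h : ConvergesTo T w ξ) (v : V) : ∀ᶠ n in atTop, w n ≠ v := by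
  obtain ⟨r, rfl⟩ := exists_endpoint_eq ξ
  obtain ⟨N, hN⟩ := r.eventually_dist_succ hT v
  let d : T.Dart := ⟨(r.toFun N, r.toFun (N + 1)), r.adj N⟩
  have hv : v ∉ halfTree T d := by
    rw [mem_halfTree_iff hT]
    have := hN N le_rfl
    change ¬ T.dist (r.toFun (N + 1)) v < T.dist (r.toFun N) v
    lia
  have hd : r.endpoint ∈ side T d := by
    rw [endpoint_mem_side hT]
    refine eventually_atTop.2 ⟨N + 1, fun n hn => ?_⟩
    rw [mem_halfTree_iff hT]
    obtain ⟨k, rfl⟩ := Nat.exists_eq_add_of_le hn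
    change T.dist (r.toFun (N + 1)) _ < T.dist (r.toFun N) _
    have h1 := r.dist_eq N (1 + k)
    rw [← add_assoc] at h1
    rw [r.dist_eq, h1]
    lia
  filter_upwards [h d hd] with n hn hnv
  exact hv (hnv ▸ hn)

theorem ConvergesTo.eventually_notMem (hT : T.IsTree) {w : ℕ → V} {ξ : GromovBoundary T}
    (h : ConvergesTo T w ξ) {F : Set V} (hF : F.Finite) : ∀ᶠ n in atTop, w n ∉ F := by
  have := (eventually_all_finite hF).2 fun v _ => h.eventually_ne hT v
  filter_upwards [this] with n hn hnF
  exact hn _ hnF rfl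

/-- A sequence at bounded distance from a convergent one converges to the same point. -/
theorem ConvergesTo.of_dist_le (hT : T.IsTree) (hf : ∀ v, (T.neighborSet v).Finite)
    {w w' : ℕ → V} {ξ : GromovBoundary T} (h : ConvergesTo T w ξ) (K : ℕ)
    (hK : ∀ n, T.dist (w n) (w' n) ≤ K) : ConvergesTo T w' ξ := by
  intro d hd
  filter_upwards [h d hd, h.eventually_notMem hT (finite_ball hT hf d.snd K)] with n h1 h2
  by_contra h3
  have h4 := dist_eq_of_mem_of_notMem hT h1 h3
  have h5 := hK n
  exact h2 (show T.dist _ _ ≤ K by lia)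

theorem ConvergesTo.comp {w : ℕ → V} {ξ : GromovBoundary T} (h : ConvergesTo T w ξ) {φ : ℕ → ℕ}
    (hφ : StrictMono φ) : ConvergesTo T (w ∘ φ) ξ :=
  fun d hd => hφ.tendsto_atTop.eventually (h d hd)

theorem ConvergesTo.mem_side (hT : T.IsTree) {w : ℕ → V} {ξ : GromovBoundary T}
    (h : ConvergesTo T w ξ) {d : T.Dart} (hd : ∃ᶠ n in atTop, w n ∈ halfTree T d) :
    ξ ∈ side T d := by
  by_contra hξ
  rw [← Set.mem_compl_iff, ← side_symm hT] at hξ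
  obtain ⟨n, h1, h2⟩ := (hd.and_eventually (h _ hξ)).exists
  exact (mem_halfTree_symm hT).1 h2 h1

/-- A sequence of adjacent vertices moving away from `o` is a geodesic ray. -/
def rayOfDist (hT : T.IsTree) (o : V) (r : ℕ → V) (hadj : ∀ n, T.Adj (r n) (r (n + 1)))
    (hd : ∀ n, T.dist (r n) o = n) : GeodesicRay T where
  toFun := r
  geodesic m k := by
    rw [← (hT.connected.preconnected _ _).coe_dist_eq_edist]
    congr 1
    apply le_antisymm
    · induction k with
      | zero => simp
      | succ k ih =>
        have h1 := hT.connected.dist_triangle (u := r m) (v := r (m + k)) (w := r (m + (k + 1)))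
        have h2 : T.dist (r (m + k)) (r (m + (k + 1))) = 1 :=
          SimpleGraph.dist_eq_one_iff_adj.2 (hadj (m + k))
        lia
    · have h1 := hT.connected.dist_triangle (u := r (m + k)) (v := r m) (w := o)
      rw [hd, hd, T.dist_comm] at h1
      lia

/-- Compactness of the compactification of a locally finite tree by its boundary. -/
theorem exists_convergesTo (hT : T.IsTree) (hf : ∀ v, (T.neighborSet v).Finite)
    (w : ℕ → V) (hw : ∀ v, {n | w n = v}.Finite) :
    ∃ φ : ℕ → ℕ, StrictMono φ ∧ ∃ ξ, ConvergesTo T (w ∘ φ) ξ := by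
  have ⟨o⟩ := hT.connected.nonempty
  -- `D v` collects the indices for which `v` lies on the geodesic from `o` to `w n`. König's
  -- argument follows vertices with infinite `D v` outwards.
  let D : V → Set ℕ := fun v => {n | T.dist (w n) o = T.dist v o + T.dist (w n) v}
  have step : ∀ v, (D v).Infinite → ∃ a, T.Adj v a ∧ T.dist a o = T.dist v o + 1 ∧
      (D a).Infinite := by
    intro v hv
    by_contra! hcon
    refine hv (((hw v).union ((hf v).biUnion
      (t := fun a => {n | n ∈ D a ∧ T.dist a o = T.dist v o + 1}) ?_)).subset ?_)
    · intro a ha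
      by_cases h : T.dist a o = T.dist v o + 1
      · exact (hcon a ha h).subset fun n hn => hn.1
      · exact Set.finite_empty.subset fun n hn => h hn.2
    · intro n hn
      by_cases h : w n = v
      · exact Or.inl h
      obtain ⟨a, ha, had⟩ := exists_adj_dist_lt hT (o := w n) (u := v) (Ne.symm h)
      right
      have hn' : T.dist (w n) o = T.dist v o + T.dist (w n) v := hn
      have h1 := hT.connected.dist_triangle (u := w n) (v := a) (w := o)
      rw [T.dist_comm (u := v), T.dist_comm (u := a)] at had
      have h2 : T.dist a o = T.dist v o + 1 := by
        rcases dist_adj hT o ha with h | h <;> lia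
      simp only [Set.mem_iUnion]
      refine ⟨a, ha, ?_, h2⟩
      change T.dist (w n) o = T.dist a o + T.dist (w n) a
      lia
  choose! nxt h1 h2 h3 using step
  let r : ℕ → V := fun n => Nat.rec o (fun _ v => nxt v) n
  have hr : ∀ n, (D (r n)).Infinite := by
    intro n
    induction n with
    | zero =>
      have : D o = Set.univ := by ext n; simp [D]
      change (D o).Infinite
      rw [this]
      exact Set.infinite_univ
    | succ n ih => exact h3 _ ih
  have hd : ∀ n, T.dist (r n) o = n := by
    intro n
    induction n with
    | zero => exact SimpleGraph.dist_self
    | succ n ih => exact (h2 _ (hr n)).trans (by rw [ih])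
  let R := rayOfDist hT o r (fun n => h1 _ (hr n)) hd
  obtain ⟨φ, hφ, hφD⟩ := extraction_forall_of_frequently
    (P := fun k n => n ∈ D (r k)) fun k => Nat.frequently_atTop_iff_infinite.2 (hr k)
  refine ⟨φ, hφ, R.endpoint, fun d hd' => ?_⟩
  rw [endpoint_mem_side hT] at hd'
  filter_upwards [hd', eventually_ge_atTop (T.dist d.fst o)] with k hk hk'
  -- Otherwise the geodesic from `o` to `w (φ k)`, which passes through `r k`, would return to
  -- `d.fst`, forcing `k < T.dist d.fst o`.
  by_contra hx
  have h4 : T.dist (w (φ k)) o = T.dist (r k) o + T.dist (w (φ k)) (r k) := hφD k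
  have h5 := dist_eq_of_mem_of_notMem hT hk hx
  have h6 := hT.connected.dist_triangle (u := w (φ k)) (v := d.fst) (w := o)
  rw [T.dist_comm (u := w (φ k)) (v := d.fst)] at h6
  change T.dist (r k) (w (φ k)) = _ at h5
  rw [hd, T.dist_comm (u := w (φ k)) (v := r k)] at h4
  lia

/-- In a tree without leaves, half-trees are infinite. -/
theorem halfTree_infinite (hT : T.IsTree) (hn : ∀ v, (T.neighborSet v).Nontrivial) (d : T.Dart) :
    (halfTree T d).Infinite := by
  intro hfin
  obtain ⟨u, hu, hmax⟩ := Set.exists_max_image _ (fun u => T.dist u d.fst) hfin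
    ⟨_, snd_mem_halfTree d⟩
  obtain ⟨a, ha, b, hb, hab⟩ := hn u
  have key : ∀ a, T.Adj u a → T.dist u d.fst = T.dist a d.fst + 1 := by
    intro a ha
    rcases dist_adj hT d.fst ha with h | h
    · exact h
    by_cases had : a ∈ halfTree T d
    · have := hmax a had
      lia
    · obtain ⟨-, rfl⟩ := eq_snd_of_adj_of_mem_of_notMem hT ha hu had
      rw [SimpleGraph.dist_self] at h
      lia
  -- Both neighbours of the farthest vertex are closer to `d.fst`, but only one neighbour can be.
  have h1 := key a ha
  have h2 := key b hb
  exact hab (eq_of_adj_of_dist_lt hT (o := d.fst) ha hb (by lia) (by lia))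

theorem side_nonempty (hT : T.IsTree) (hf : ∀ v, (T.neighborSet v).Finite)
    (hn : ∀ v, (T.neighborSet v).Nontrivial) (d : T.Dart) : (side T d).Nonempty := by
  have hinf := halfTree_infinite hT hn d
  let w : ℕ → V := fun n => (hinf.natEmbedding _ n).1
  have hw : Function.Injective w := Subtype.val_injective.comp (hinf.natEmbedding _).injective
  obtain ⟨φ, -, ξ, h⟩ := exists_convergesTo hT hf w fun v =>
    (Set.finite_singleton v).preimage hw.injOn
  exact ⟨ξ, h.mem_side hT (Eventually.frequently
    (Eventually.of_forall fun n => (hinf.natEmbedding _ (φ n)).2))⟩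

end Convergence

end TreeCore

namespace TreeCore

/-! ### Translating boundary intersections into a coarse map between the trees. -/

section Action

variable {V V' : Type*} {Γ : Type*} [Group Γ] {T : SimpleGraph V} {T' : SimpleGraph V'}

theorem dist_map_iso (φ : T ≃g T) (u v : V) : T.dist (φ u) (φ v) = T.dist u v := by
  have key : ∀ (φ : T ≃g T) u v, T.edist (φ u) (φ v) ≤ T.edist u v := by
    intro φ u v
    by_cases h : T.edist u v = ⊤
    · rw [h]; exact le_top
    obtain ⟨p, hp⟩ := SimpleGraph.exists_walk_of_edist_ne_top h
    rw [← hp, ← SimpleGraph.Walk.length_map φ.toHom p]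
    exact SimpleGraph.edist_le _
  rw [SimpleGraph.dist, SimpleGraph.dist]
  congr 1
  refine le_antisymm (key φ u v) ?_
  simpa using key φ.symm (φ u) (φ v)

theorem dist_map_map (ρ : Γ →* (T ≃g T)) (γ δ : Γ) (u v : V) :
    T.dist (ρ γ u) (ρ δ v) = T.dist u (ρ (γ⁻¹ * δ) v) := by
  have : ρ δ v = ρ γ (ρ (γ⁻¹ * δ) v) := by
    rw [← RelIso.mul_apply, ← map_mul, mul_inv_cancel_left]
  rw [this, dist_map_iso]

theorem map_mul_apply (ρ : Γ →* (T ≃g T)) (γ δ : Γ) (v : V) : ρ (γ * δ) v = ρ γ (ρ δ v) := by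
  rw [map_mul, RelIso.mul_apply]

theorem map_eq_map_iff (ρ : Γ →* (T ≃g T)) (γ δ : Γ) (u v : V) :
    ρ γ u = ρ δ v ↔ ρ (δ⁻¹ * γ) u = v := by
  constructor
  · intro h
    rw [map_mul_apply, h, ← map_mul_apply, inv_mul_cancel, map_one, RelIso.one_apply]
  · rintro rfl
    rw [← map_mul_apply, mul_inv_cancel_left]

theorem convergesTo_of_convergesTo (hT : T.IsTree) (hf : ∀ v, (T.neighborSet v).Finite)
    {ρ : Γ →* (T ≃g T)} {γ : ℕ → Γ} {ξ : GromovBoundary T} {v₀ : V}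
    (h : ConvergesTo T (fun n => ρ (γ n) v₀) ξ) (v : V) :
    ConvergesTo T (fun n => ρ (γ n) v) ξ :=
  h.of_dist_le hT hf (T.dist v₀ v) fun _ => (dist_map_iso _ _ _).le

/-- Compactness for sequences of group elements. -/
theorem exists_convergesTo_orbit (hT : T.IsTree) (hf : ∀ v, (T.neighborSet v).Finite)
    {ρ : Γ →* (T ≃g T)} (hρ : IsGeometricAction ρ) (γ : ℕ → Γ) (hγ : ∀ δ, {n | γ n = δ}.Finite) :
    ∃ φ : ℕ → ℕ, StrictMono φ ∧ ∃ ξ, ∀ v, ConvergesTo T (fun n => ρ (γ (φ n)) v) ξ := by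
  have ⟨o⟩ := hT.connected.nonempty
  obtain ⟨φ, hφ, ξ, h⟩ := exists_convergesTo hT hf (fun n => ρ (γ n) o) fun v =>
    ((hρ.properlyDiscontinuous o v).biUnion fun δ _ => hγ δ).subset fun n hn => by
      simp only [Set.mem_iUnion]
      exact ⟨γ n, hn, rfl⟩
  exact ⟨φ, hφ, ξ, convergesTo_of_convergesTo hT hf (γ := γ ∘ φ) h⟩

/-- Every boundary point of `T` is identified with a boundary point of `T'`. -/
theorem exists_identified (hT : T.IsTree) (hT' : T'.IsTree) (hf : ∀ v, (T.neighborSet v).Finite)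
    (hf' : ∀ v, (T'.neighborSet v).Finite) {ρ : Γ →* (T ≃g T)} {ρ' : Γ →* (T' ≃g T')}
    (hρ : IsGeometricAction ρ) (hρ' : IsGeometricAction ρ') (ξ : GromovBoundary T) :
    ∃ ξ', Identified ρ ρ' ξ ξ' := by
  have ⟨o⟩ := hT.connected.nonempty
  obtain ⟨r, rfl⟩ := exists_endpoint_eq ξ
  obtain ⟨s, hs, hcov⟩ := hρ.cocompact
  -- By cocompactness the ray is shadowed by orbit points `ρ (γ n) o`; a subsequence of `γ` then
  -- converges in `T'` as well.
  choose γ b hb hγ using fun n => hcov (r.toFun n)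
  have hrinj : Function.Injective r.toFun := by
    intro m n hmn
    wlog h : m ≤ n generalizing m n
    · exact (this hmn.symm (by lia)).symm
    obtain ⟨k, rfl⟩ := Nat.exists_eq_add_of_le h
    have := r.dist_eq m k
    rw [hmn, SimpleGraph.dist_self] at this
    lia
  have hconv : ConvergesTo T r.toFun r.endpoint := fun d hd => (endpoint_mem_side hT r d).1 hd
  obtain ⟨K, hK⟩ := (hs.image fun x => T.dist x o).bddAbove
  have h1 : ConvergesTo T (fun n => ρ (γ n) o) r.endpoint := by
    refine hconv.of_dist_le hT hf K fun n => ?_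
    rw [← hγ n, dist_map_iso]
    exact hK ⟨b n, hb n, rfl⟩
  obtain ⟨φ, hφ, ξ', h2⟩ := exists_convergesTo_orbit hT' hf' hρ' γ fun δ => by
    refine ((hs.image (ρ δ)).preimage hrinj.injOn).subset ?_
    rintro n rfl
    exact ⟨b n, hb n, hγ n⟩
  exact ⟨ξ', γ ∘ φ, fun v => (convergesTo_of_convergesTo hT hf h1 v).comp hφ, h2⟩

/-- A choice, for every vertex, of a group element moving a vertex of a fixed finite set
to it. -/
def IsOrbitSection (ρ : Γ →* (T ≃g T)) (c : V → Γ) : Prop :=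
  ∃ s : Set V, s.Finite ∧ ∀ v, ∃ b ∈ s, ρ (c v) b = v

theorem IsGeometricAction.exists_isOrbitSection {ρ : Γ →* (T ≃g T)} (hρ : IsGeometricAction ρ) :
    ∃ c, IsOrbitSection ρ c := by
  obtain ⟨s, hs, hcov⟩ := hρ.cocompact
  choose c b hb hc using hcov
  exact ⟨c, s, hs, fun v => ⟨b v, hb v, hc v⟩⟩

theorem IsOrbitSection.finite_fiber {ρ : Γ →* (T ≃g T)} {c : V → Γ} (hc : IsOrbitSection ρ c)
    (γ : Γ) : {v | c v = γ}.Finite := by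
  obtain ⟨s, hs, h⟩ := hc
  refine (hs.image (ρ γ)).subset ?_
  rintro v rfl
  obtain ⟨b, hb, h⟩ := h v
  exact ⟨b, hb, h⟩

/-- The half-trees of `d` and `d'` have a common boundary point, in terms of a coarse map
`f` from `T'` to `T`. -/
def Meets (f : V' → V) (d : T.Dart) (d' : T'.Dart) : Prop :=
  {u | u ∈ halfTree T' d' ∧ f u ∈ halfTree T d}.Infinite

/-- All half-trees of the edge `e` meet all half-trees of `e'`. -/
def Crosses (T : SimpleGraph V) (T' : SimpleGraph V') (f : V' → V) (e : Sym2 V) (e' : Sym2 V') :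
    Prop :=
  ∀ (a : T.Dart) (b : T'.Dart), a.edge = e → b.edge = e' → Meets f a b

theorem crosses_edge_iff {f : V' → V} {d : T.Dart} {d' : T'.Dart} :
    Crosses T T' f d.edge d'.edge ↔
      (Meets f d d' ∧ Meets f d.symm d') ∧ Meets f d d'.symm ∧ Meets f d.symm d'.symm := by
  constructor
  · exact fun h => ⟨⟨h _ _ rfl rfl, h _ _ d.edge_symm rfl⟩, h _ _ rfl d'.edge_symm,
      h _ _ d.edge_symm d'.edge_symm⟩
  · rintro ⟨⟨h1, h2⟩, h3, h4⟩ a b ha hb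
    rcases SimpleGraph.dart_edge_eq_iff a d |>.1 ha with rfl | rfl <;>
    rcases SimpleGraph.dart_edge_eq_iff b d' |>.1 hb with rfl | rfl <;> assumption

/-- The witnesses are `u = ρ' (γ n) o` for large `n`. Here `c u = γ n * δ` with `δ` in a finite set,
so convergence in `T` for the finitely many base points `ρ δ v₀` controls the image of `u`. -/
theorem meets_of_identified (hT' : T'.IsTree) {ρ : Γ →* (T ≃g T)} {ρ' : Γ →* (T' ≃g T')}
    (hρ' : IsGeometricAction ρ') {c : V' → Γ} (hc : IsOrbitSection ρ' c) (v₀ : V)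
    {ξ : GromovBoundary T} {ξ' : GromovBoundary T'} (h : Identified ρ ρ' ξ ξ')
    {d : T.Dart} {d' : T'.Dart} (hd : ξ ∈ side T d) (hd' : ξ' ∈ side T' d') :
    Meets (fun u => ρ (c u) v₀) d d' := by
  have ⟨o⟩ := hT'.connected.nonempty
  obtain ⟨s, hs, hcs⟩ := hc
  obtain ⟨γ, h1, h2⟩ := h
  intro hfin
  have h3 : ∀ᶠ n in atTop, ∀ δ ∈ ⋃ b ∈ s, {δ | ρ' δ b = o}, ρ (γ n) (ρ δ v₀) ∈ halfTree T d :=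
    (eventually_all_finite (hs.biUnion fun b _ => hρ'.properlyDiscontinuous b o)).2
      fun δ _ => h1 _ d hd
  obtain ⟨n, h4, h5, h6⟩ := (h3.and ((h2 o d' hd').and
    ((h2 o).eventually_notMem hT' hfin))).exists
  refine h6 ⟨h5, ?_⟩
  obtain ⟨b, hb, hbc⟩ := hcs (ρ' (γ n) o)
  rw [map_eq_map_iff] at hbc
  have h7 := h4 ((γ n)⁻¹ * c (ρ' (γ n) o)) (by
    simp only [Set.mem_iUnion]; exact ⟨b, hb, hbc⟩)
  rwa [← map_mul_apply, mul_inv_cancel_left] at h7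

/-- Compactness: from infinitely many common vertices, extract a sequence whose group elements
converge in both trees. -/
theorem Meets.exists_identified (hT : T.IsTree) (hT' : T'.IsTree)
    (hf : ∀ v, (T.neighborSet v).Finite)
    (hf' : ∀ v, (T'.neighborSet v).Finite) {ρ : Γ →* (T ≃g T)} {ρ' : Γ →* (T' ≃g T')}
    (hρ : IsGeometricAction ρ) (hρ' : IsGeometricAction ρ')
    {c : V' → Γ} (hc : IsOrbitSection ρ' c) (v₀ : V) {d : T.Dart} {d' : T'.Dart}
    (h : Meets (fun u => ρ (c u) v₀) d d') :
    ∃ ξ ∈ side T d, ∃ ξ' ∈ side T' d', Identified ρ ρ' ξ ξ' := by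
  let u : ℕ → V' := fun n => (Set.Infinite.natEmbedding _ h n).1
  have hu : Function.Injective u :=
    Subtype.val_injective.comp (Set.Infinite.natEmbedding _ h).injective
  have hud : ∀ n, u n ∈ halfTree T' d' ∧ ρ (c (u n)) v₀ ∈ halfTree T d := fun n =>
    (Set.Infinite.natEmbedding _ h n).2
  obtain ⟨φ, hφ, ξ, h1⟩ := exists_convergesTo_orbit hT hf hρ (c ∘ u) fun δ =>
    (hc.finite_fiber δ).preimage hu.injOn
  obtain ⟨ψ, hψ, ξ', h2⟩ := exists_convergesTo_orbit hT' hf' hρ' (c ∘ u ∘ φ) fun δ =>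
    (hc.finite_fiber δ).preimage (hu.comp hφ.injective).injOn
  refine ⟨ξ, ?_, ξ', ?_, c ∘ u ∘ φ ∘ ψ, fun v => (h1 v).comp hψ, h2⟩
  · exact (h1 v₀).mem_side hT (Eventually.frequently (Eventually.of_forall fun n => (hud _).2))
  · obtain ⟨s, hs, hcs⟩ := hc
    by_contra hξ
    rw [← Set.mem_compl_iff, ← side_symm hT'] at hξ
    -- The base point `b` of `u` varies with `u`, so convergence is used for all of the finite set
    -- `s` at once.
    obtain ⟨n, hn⟩ := ((eventually_all_finite hs).2 fun b _ => h2 b _ hξ).exists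
    obtain ⟨b, hb, hbc⟩ := hcs (u (φ (ψ n)))
    have h3 := hn b hb
    change ρ' (c (u (φ (ψ n)))) b ∈ _ at h3
    rw [hbc, mem_halfTree_symm hT'] at h3
    exact h3 (hud _).1

theorem edgePartition'_edge (ρ : Γ →* (T ≃g T)) (ρ' : Γ →* (T' ≃g T')) (d' : T'.Dart) :
    edgePartition' ρ ρ' d'.edge =
      {transport ρ ρ' (side T' d'), transport ρ ρ' (side T' d'.symm)} := by
  rw [edgePartition', edgePartition_edge, Set.image_pair]

/-- The partitions of two edges are non-nested if and only if all pairs of half-trees meet. -/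
theorem nonNested_iff (hT : T.IsTree) (hT' : T'.IsTree) (hf : ∀ v, (T.neighborSet v).Finite)
    (hf' : ∀ v, (T'.neighborSet v).Finite) {ρ : Γ →* (T ≃g T)} {ρ' : Γ →* (T' ≃g T')}
    (hρ : IsGeometricAction ρ) (hρ' : IsGeometricAction ρ')
    {c : V' → Γ} (hc : IsOrbitSection ρ' c) (v₀ : V) (e : Sym2 V) (e' : Sym2 V') :
    NonNested (edgePartition T e) (edgePartition' ρ ρ' e') ↔
      Crosses T T' (fun u => ρ (c u) v₀) e e' := by
  constructor
  · intro h a b ha hb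
    obtain ⟨ξ, h1, ξ', h2, h3⟩ := h (side T a) ⟨a, ha, rfl⟩ (transport ρ ρ' (side T' b))
      ⟨_, ⟨b, hb, rfl⟩, rfl⟩
    exact meets_of_identified hT' hρ' hc v₀ h3 h1 h2
  · rintro h _ ⟨a, ha, rfl⟩ _ ⟨_, ⟨b, hb, rfl⟩, rfl⟩
    obtain ⟨ξ, h1, ξ', h2, h3⟩ := (h a b ha hb).exists_identified hT hT' hf hf' hρ hρ' hc v₀
    exact ⟨ξ, h1, ξ', h2, h3⟩

/-- The two empty intersections are the two inclusions between the sides of `d` and `d'`. In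
contrapositive form this feeds the distinctness of partitions into the combinatorics. -/
theorem edgePartition_eq_of_not_meets (hT : T.IsTree) (hT' : T'.IsTree)
    (hf : ∀ v, (T.neighborSet v).Finite)
    (hf' : ∀ v, (T'.neighborSet v).Finite) {ρ : Γ →* (T ≃g T)} {ρ' : Γ →* (T' ≃g T')}
    (hρ : IsGeometricAction ρ) (hρ' : IsGeometricAction ρ')
    {c : V' → Γ} (hc : IsOrbitSection ρ' c) (v₀ : V) {d : T.Dart} {d' : T'.Dart}
    (h1 : ¬ Meets (fun u => ρ (c u) v₀) d d'.symm)
    (h2 : ¬ Meets (fun u => ρ (c u) v₀) d.symm d') :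
    edgePartition T d.edge = edgePartition' ρ ρ' d'.edge := by
  have key : ∀ (d : T.Dart) (d' : T'.Dart), ¬ Meets (fun u => ρ (c u) v₀) d d'.symm →
      ¬ Meets (fun u => ρ (c u) v₀) d.symm d' → side T d = transport ρ ρ' (side T' d') := by
    intro d d' h1 h2
    ext ξ
    constructor
    · intro hξ
      obtain ⟨ξ', h⟩ := exists_identified hT hT' hf hf' hρ hρ' ξ
      refine ⟨ξ', ?_, h⟩
      by_contra hξ'
      rw [← Set.mem_compl_iff, ← side_symm hT'] at hξ'
      exact h1 (meets_of_identified hT' hρ' hc v₀ h hξ hξ')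
    · rintro ⟨ξ', hξ', h⟩
      by_contra hξ
      rw [← Set.mem_compl_iff, ← side_symm hT] at hξ
      exact h2 (meets_of_identified hT' hρ' hc v₀ h hξ hξ')
  rw [edgePartition_edge, edgePartition'_edge, key d d' h1 h2, key d.symm d'.symm]
  · rwa [SimpleGraph.Dart.symm_symm]
  · rwa [SimpleGraph.Dart.symm_symm]

/-- A coarse map between trees: Lipschitz, with finite fibres, such that preimages of half-trees
are infinite. -/
structure IsCoarseMap (T : SimpleGraph V) (T' : SimpleGraph V') (f : V' → V) : Prop where
  finite_fiber : ∀ v, {u | f u = v}.Finite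
  lipschitz : ∃ K, ∀ u w, T'.Adj u w → T.dist (f u) (f w) ≤ K
  infinite_preimage : ∀ d : T.Dart, {u | f u ∈ halfTree T d}.Infinite

/-- For adjacent `u`, `w` the element `(c u)⁻¹ * c w` ranges over a finite set, which gives the
Lipschitz bound. Preimages of half-trees are infinite because every side contains a boundary point.
-/
theorem isCoarseMap_orbitSection (hT : T.IsTree) (hT' : T'.IsTree)
    (hf : ∀ v, (T.neighborSet v).Finite) (hn : ∀ v, (T.neighborSet v).Nontrivial)
    (hf' : ∀ v, (T'.neighborSet v).Finite) (hn' : ∀ v, (T'.neighborSet v).Nontrivial)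
    {ρ : Γ →* (T ≃g T)} {ρ' : Γ →* (T' ≃g T')}
    (hρ : IsGeometricAction ρ) (hρ' : IsGeometricAction ρ')
    {c : V' → Γ} (hc : IsOrbitSection ρ' c) (v₀ : V) :
    IsCoarseMap T T' (fun u => ρ (c u) v₀) where
  finite_fiber v := by
    refine ((hρ.properlyDiscontinuous v₀ v).biUnion fun δ _ => hc.finite_fiber δ).subset ?_
    intro u hu
    simp only [Set.mem_iUnion]
    exact ⟨c u, hu, rfl⟩
  lipschitz := by
    obtain ⟨s, hs, hcs⟩ := hc
    have hfin : (⋃ b ∈ s, ⋃ b' ∈ s, ⋃ a ∈ T'.neighborSet b, {δ | ρ' δ b' = a}).Finite :=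
      hs.biUnion fun b _ => hs.biUnion fun b' _ => (hf' b).biUnion fun a _ =>
        hρ'.properlyDiscontinuous b' a
    obtain ⟨K, hK⟩ := (hfin.image fun δ => T.dist v₀ (ρ δ v₀)).bddAbove
    refine ⟨K, fun u w huw => ?_⟩
    rw [dist_map_map]
    refine hK ⟨_, ?_, rfl⟩
    obtain ⟨b, hb, hbu⟩ := hcs u
    obtain ⟨b', hb', hbw⟩ := hcs w
    simp only [Set.mem_iUnion]
    refine ⟨b, hb, b', hb', ρ' ((c u)⁻¹ * c w) b', ?_, rfl⟩
    rw [SimpleGraph.mem_neighborSet, ← (ρ' (c u)).map_adj_iff, ← map_mul_apply,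
      mul_inv_cancel_left, hbu, hbw]
    exact huw
  infinite_preimage d := by
    have ⟨o⟩ := hT'.connected.nonempty
    obtain ⟨a, ha⟩ := (hn' o).nonempty
    obtain ⟨ξ, hξ⟩ := side_nonempty hT hf hn d
    obtain ⟨ξ', h⟩ := exists_identified hT hT' hf hf' hρ hρ' ξ
    let d' : T'.Dart := ⟨(o, a), ha⟩
    by_cases hξ' : ξ' ∈ side T' d'
    · exact (meets_of_identified hT' hρ' hc v₀ h hξ hξ').mono fun u hu => hu.2
    · rw [← Set.mem_compl_iff, ← side_symm hT'] at hξ'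
      exact (meets_of_identified hT' hρ' hc v₀ h hξ hξ').mono fun u hu => hu.2

end Action

end TreeCore

namespace TreeCore

/-! ### The three branches at a trivalent vertex. -/

section Tripod

variable {V V' : Type*} {T' : SimpleGraph V'} {T : SimpleGraph V}

/-- The three oriented edges that start at a trivalent vertex. -/
structure Tripod (d₁ d₂ d₃ : T.Dart) : Prop where
  fst₂ : d₂.fst = d₁.fst
  fst₃ : d₃.fst = d₁.fst
  ne₁₂ : d₁.snd ≠ d₂.snd
  ne₁₃ : d₁.snd ≠ d₃.snd
  ne₂₃ : d₂.snd ≠ d₃.snd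
  cover : ∀ a, T.Adj d₁.fst a → a = d₁.snd ∨ a = d₂.snd ∨ a = d₃.snd

theorem Tripod.rotate {d₁ d₂ d₃ : T.Dart} (h : Tripod d₁ d₂ d₃) : Tripod d₂ d₃ d₁ where
  fst₂ := h.fst₃.trans h.fst₂.symm
  fst₃ := h.fst₂.symm
  ne₁₂ := h.ne₂₃
  ne₁₃ := h.ne₁₂.symm
  ne₂₃ := h.ne₁₃.symm
  cover a ha := by
    rw [h.fst₂] at ha
    have := h.cover a ha
    tauto

theorem exists_tripod (hT3 : Trivalent T) (d : T.Dart) : ∃ d₂ d₃, Tripod d d₂ d₃ := by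
  obtain ⟨x, y, z, hxy, hxz, hyz, h⟩ := Set.ncard_eq_three.1 (hT3 d.fst)
  have hadj : ∀ a, T.Adj d.fst a ↔ a = x ∨ a = y ∨ a = z := fun a => by
    rw [← SimpleGraph.mem_neighborSet, h]; rfl
  have hx := (hadj x).2 (by simp)
  have hy := (hadj y).2 (by simp)
  have hz := (hadj z).2 (by simp)
  rcases (hadj d.snd).1 d.adj with hd | hd | hd
  · exact ⟨⟨(d.fst, y), hy⟩, ⟨(d.fst, z), hz⟩, rfl, rfl, hd ▸ hxy, hd ▸ hxz, hyz,
      fun a ha => by simpa [hd] using (hadj a).1 ha⟩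
  · exact ⟨⟨(d.fst, x), hx⟩, ⟨(d.fst, z), hz⟩, rfl, rfl, hd ▸ hxy.symm, hd ▸ hyz, hxz,
      fun a ha => by have := (hadj a).1 ha; simp only [hd]; tauto⟩
  · exact ⟨⟨(d.fst, x), hx⟩, ⟨(d.fst, y), hy⟩, rfl, rfl, hd ▸ hxz.symm, hd ▸ hyz.symm, hxy,
      fun a ha => by have := (hadj a).1 ha; simp only [hd]; tauto⟩

theorem Tripod.mem_symm (hT : T.IsTree) {d₁ d₂ d₃ : T.Dart} (h : Tripod d₁ d₂ d₃) {w : V} :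
    w ∈ halfTree T d₁.symm ↔ w = d₁.fst ∨ w ∈ halfTree T d₂ ∨ w ∈ halfTree T d₃ := by
  rw [mem_halfTree_symm hT]
  constructor
  · intro hw
    by_cases hwv : w = d₁.fst
    · exact Or.inl hwv
    obtain ⟨a, ha, hd⟩ := exists_adj_dist_lt hT (Ne.symm hwv)
    rcases h.cover a ha with rfl | rfl | rfl
    · exact absurd ((mem_halfTree_iff hT).2 (by lia)) hw
    · exact Or.inr (Or.inl ((mem_halfTree_iff hT).2 (by rw [h.fst₂]; lia)))
    · exact Or.inr (Or.inr ((mem_halfTree_iff hT).2 (by rw [h.fst₃]; lia)))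
  · rintro (rfl | hw | hw)
    · exact fst_notMem_halfTree hT d₁
    · exact notMem_halfTree_of_ne hT h.fst₂ h.ne₁₂.symm hw
    · exact notMem_halfTree_of_ne hT h.fst₃ h.ne₁₃.symm hw

/-- The complement of one branch is the other two together with the vertex, whose fibre is finite
and does not affect infinitude. -/
theorem Tripod.meets_symm_left (hT : T.IsTree) {f : V' → V} (hf : ∀ v, {u | f u = v}.Finite)
    {d₁ d₂ d₃ : T.Dart} (h : Tripod d₁ d₂ d₃) (d' : T'.Dart) :
    Meets f d₁.symm d' ↔ Meets f d₂ d' ∨ Meets f d₃ d' := by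
  rw [Meets, Meets, Meets, ← Set.infinite_union]
  constructor
  · intro h' hfin
    refine h' ((hfin.union (hf d₁.fst)).subset ?_)
    rintro u ⟨hu, hu'⟩
    rcases (h.mem_symm hT).1 hu' with h1 | h1 | h1
    · exact Or.inr h1
    · exact Or.inl (Or.inl ⟨hu, h1⟩)
    · exact Or.inl (Or.inr ⟨hu, h1⟩)
  · intro h'
    refine h'.mono ?_
    rintro u (⟨hu, hu'⟩ | ⟨hu, hu'⟩)
    · exact ⟨hu, (h.mem_symm hT).2 (Or.inr (Or.inl hu'))⟩
    · exact ⟨hu, (h.mem_symm hT).2 (Or.inr (Or.inr hu'))⟩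

theorem Tripod.meets_symm_right (hT' : T'.IsTree) {f : V' → V} {d₁ d₂ d₃ : T'.Dart}
    (h : Tripod d₁ d₂ d₃) (d : T.Dart) :
    Meets f d d₁.symm ↔ Meets f d d₂ ∨ Meets f d d₃ := by
  rw [Meets, Meets, Meets, ← Set.infinite_union]
  constructor
  · intro h' hfin
    refine h' ((hfin.union (Set.finite_singleton d₁.fst)).subset ?_)
    rintro u ⟨hu, hu'⟩
    rcases (h.mem_symm hT').1 hu with h1 | h1 | h1
    · exact Or.inr h1
    · exact Or.inl (Or.inl ⟨h1, hu'⟩)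
    · exact Or.inl (Or.inr ⟨h1, hu'⟩)
  · intro h'
    refine h'.mono ?_
    rintro u (⟨hu, hu'⟩ | ⟨hu, hu'⟩)
    · exact ⟨(h.mem_symm hT').2 (Or.inr (Or.inl hu)), hu'⟩
    · exact ⟨(h.mem_symm hT').2 (Or.inr (Or.inr hu)), hu'⟩

end Tripod

/-! ### Subtrees cut out by monotone properties of half-trees. -/

section Rich

variable {V : Type*} {T : SimpleGraph V}

/-- The end points of the edges both of whose half-trees satisfy `B`. -/
def richVerts (T : SimpleGraph V) (B : T.Dart → Prop) : Set V :=
  {u | ∃ d : T.Dart, d.snd = u ∧ B d ∧ B d.symm}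

/-- A property of half-trees that passes to larger ones. -/
def HalfTreeMonotone (B : T.Dart → Prop) : Prop :=
  ∀ d d' : T.Dart, halfTree T d ⊆ halfTree T d' → B d → B d'

/-- A half-tree containing an end of an edge `d₁` contains one of the two half-trees of `d₁`, and
both satisfy `B`. -/
theorem HalfTreeMonotone.of_mem_richVerts (hT : T.IsTree) {B : T.Dart → Prop}
    (hB : HalfTreeMonotone B) {d : T.Dart} {a : V} (ha : a ∈ richVerts T B)
    (had : a ∈ halfTree T d) : B d := by
  obtain ⟨d₁, rfl, h1, h2⟩ := ha
  by_cases h : d₁.fst ∈ halfTree T d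
  · by_cases h' : d.fst ∈ halfTree T d₁
    · refine hB _ _ (halfTree_subset hT (d' := d₁.symm) h ?_) h2
      rwa [mem_halfTree_symm hT, not_not]
    · exact hB _ _ (halfTree_subset hT had h') h1
  · obtain ⟨h3, h4⟩ := eq_snd_of_adj_of_mem_of_notMem hT d₁.adj.symm had h
    have : d₁ = d := SimpleGraph.Dart.ext _ _ (Prod.ext h4 h3)
    exact this ▸ h1

theorem HalfTreeMonotone.treeConvex (hT : T.IsTree) {B : T.Dart → Prop}
    (hB : HalfTreeMonotone B) : TreeConvex T (richVerts T B) := by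
  rintro d ⟨a, ha, had⟩ ⟨b, hb, hbd⟩
  have h1 := hB.of_mem_richVerts hT ha had
  have h2 := hB.of_mem_richVerts hT hb hbd
  exact ⟨⟨d.symm, rfl, h2, by rwa [SimpleGraph.Dart.symm_symm]⟩, d, rfl, h1, h2⟩

/-- Thus the subgraph induced on the rich vertices has no edges besides the ones that define it. -/
theorem HalfTreeMonotone.of_fst_mem_of_snd_mem (hT : T.IsTree) {B : T.Dart → Prop}
    (hB : HalfTreeMonotone B) {d : T.Dart} (h : d.fst ∈ richVerts T B)
    (h' : d.snd ∈ richVerts T B) : B d ∧ B d.symm :=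
  ⟨hB.of_mem_richVerts hT h' (snd_mem_halfTree d),
    hB.of_mem_richVerts hT h (snd_mem_halfTree d.symm)⟩

end Rich

/-! ### Edge and vertex fibres: convex, finite and nonempty. -/

section Crossing

variable {V V' : Type*} {f : V' → V} {T' : SimpleGraph V'} {T : SimpleGraph V}

theorem halfTreeMonotone_meets (d : T.Dart) :
    HalfTreeMonotone (T := T') fun d' => Meets f d d' ∧ Meets f d.symm d' :=
  fun _ _ h h' => ⟨h'.1.mono fun _ hu => ⟨h hu.1, hu.2⟩, h'.2.mono fun _ hu => ⟨h hu.1, hu.2⟩⟩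

theorem halfTreeMonotone_meets_vertex (v : V) :
    HalfTreeMonotone (T := T') fun d' => ∀ d : T.Dart, d.fst = v → Meets f d.symm d' :=
  fun _ _ h h' d hd => (h' d hd).mono fun _ hu => ⟨h hu.1, hu.2⟩

/-- The vertices of the edges of `T'` that cross the edge `e` of `T`. -/
def edgeFiber (T : SimpleGraph V) (T' : SimpleGraph V') (f : V' → V) (e : Sym2 V) : Set V' :=
  {u | ∃ b : T'.Dart, b.snd = u ∧ Crosses T T' f e b.edge}

/-- The vertices of the edges of `T'` that cross an edge of `T` at `v`. -/
def vertexFiber (T : SimpleGraph V) (T' : SimpleGraph V') (f : V' → V) (v : V) : Set V' :=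
  {u | ∃ d : T.Dart, d.fst = v ∧ u ∈ edgeFiber T T' f d.edge}

theorem edgeFiber_eq_richVerts (d : T.Dart) : edgeFiber T T' f d.edge =
    richVerts T' fun d' => Meets f d d' ∧ Meets f d.symm d' := by
  ext u
  simp only [edgeFiber, richVerts, crosses_edge_iff, Set.mem_ofPred_eq]

theorem treeConvex_edgeFiber (hT' : T'.IsTree) {e : Sym2 V} (he : e ∈ T.edgeSet) :
    TreeConvex T' (edgeFiber T T' f e) := by
  induction e with | _ a b
  rw [show s(a, b) = (⟨(a, b), he⟩ : T.Dart).edge from rfl, edgeFiber_eq_richVerts]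
  exact (halfTreeMonotone_meets _).treeConvex hT'

theorem crosses_of_mem_edgeFiber (hT' : T'.IsTree) {e : Sym2 V} (he : e ∈ T.edgeSet) {a b : V'}
    (hab : T'.Adj a b) (ha : a ∈ edgeFiber T T' f e) (hb : b ∈ edgeFiber T T' f e) :
    Crosses T T' f e s(a, b) := by
  induction e with | _ x y
  let d : T.Dart := ⟨(x, y), he⟩
  let d' : T'.Dart := ⟨(a, b), hab⟩
  change a ∈ edgeFiber T T' f d.edge at ha
  change b ∈ edgeFiber T T' f d.edge at hb
  change Crosses T T' f d.edge d'.edge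
  rw [edgeFiber_eq_richVerts] at ha hb
  exact crosses_edge_iff.2
    ((halfTreeMonotone_meets _).of_fst_mem_of_snd_mem hT' (d := d') ha hb)

/-- At a trivalent vertex `v`, the edges that cross an edge at `v` are those with no half-tree
contained in a branch at `v`. -/
theorem exists_crosses_iff (hT : T.IsTree) (hT3 : Trivalent T) (hf : ∀ v, {u | f u = v}.Finite)
    (v : V) (d' : T'.Dart) :
    (∃ d : T.Dart, d.fst = v ∧ Crosses T T' f d.edge d'.edge) ↔
      (∀ d : T.Dart, d.fst = v → Meets f d.symm d') ∧
        ∀ d : T.Dart, d.fst = v → Meets f d.symm d'.symm := by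
  have hne : (T.neighborSet v).Nonempty := by
    rw [← Set.ncard_pos (Set.finite_of_ncard_ne_zero (by rw [hT3 v]; lia)), hT3 v]; lia
  obtain ⟨a, ha⟩ := hne
  let d₁ : T.Dart := ⟨(v, a), ha⟩
  obtain ⟨d₂, d₃, h⟩ := exists_tripod hT3 d₁
  have hall : ∀ d : T.Dart, d.fst = v ↔ d = d₁ ∨ d = d₂ ∨ d = d₃ := by
    intro d
    constructor
    · intro hd
      rcases h.cover d.snd (show T.Adj v d.snd from hd ▸ d.adj) with h1 | h1 | h1
      · exact Or.inl (SimpleGraph.Dart.ext _ _ (Prod.ext hd h1))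
      · exact Or.inr (Or.inl (SimpleGraph.Dart.ext _ _ (Prod.ext (hd.trans h.fst₂.symm) h1)))
      · exact Or.inr (Or.inr (SimpleGraph.Dart.ext _ _ (Prod.ext (hd.trans h.fst₃.symm) h1)))
    · rintro (rfl | rfl | rfl)
      · rfl
      · exact h.fst₂
      · exact h.fst₃
  have e1 := h.meets_symm_left (T' := T') hT hf
  have e2 := h.rotate.meets_symm_left (T' := T') hT hf
  have e3 := h.rotate.rotate.meets_symm_left (T' := T') hT hf
  simp only [hall, forall_eq_or_imp, exists_eq_or_imp, forall_eq, exists_eq_left,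
    crosses_edge_iff, e1, e2, e3]
  -- The right side says that at least two of the `aᵢ` and at least two of the `bᵢ` hold. Among
  -- three indices these share one, and that branch gives a crossing edge.
  generalize Meets f d₁ d' = a₁, Meets f d₂ d' = a₂, Meets f d₃ d' = a₃,
    Meets f d₁ d'.symm = b₁, Meets f d₂ d'.symm = b₂, Meets f d₃ d'.symm = b₃
  by_cases a₁ <;> by_cases a₂ <;> by_cases a₃ <;> by_cases b₁ <;> by_cases b₂ <;> simp [*]

theorem vertexFiber_eq_richVerts (hT : T.IsTree) (hT3 : Trivalent T)
    (hf : ∀ v, {u | f u = v}.Finite) (v : V) : vertexFiber T T' f v =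
      richVerts T' fun d' => ∀ d : T.Dart, d.fst = v → Meets f d.symm d' := by
  ext u
  simp only [vertexFiber, edgeFiber, richVerts, Set.mem_ofPred_eq]
  constructor
  · rintro ⟨d, hd, d', hd', h⟩
    exact ⟨d', hd', (exists_crosses_iff hT hT3 hf v d').1 ⟨d, hd, h⟩⟩
  · rintro ⟨d', hd', h⟩
    obtain ⟨d, hd, h⟩ := (exists_crosses_iff hT hT3 hf v d').2 h
    exact ⟨d, hd, d', hd', h⟩

theorem treeConvex_vertexFiber (hT : T.IsTree) (hT' : T'.IsTree) (hT3 : Trivalent T)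
    (hf : ∀ v, {u | f u = v}.Finite) (v : V) : TreeConvex T' (vertexFiber T T' f v) := by
  rw [vertexFiber_eq_richVerts hT hT3 hf]
  exact (halfTreeMonotone_meets_vertex v).treeConvex hT'

theorem exists_crosses_of_mem_vertexFiber (hT : T.IsTree) (hT' : T'.IsTree) (hT3 : Trivalent T)
    (hf : ∀ v, {u | f u = v}.Finite) {v : V} {a b : V'} (hab : T'.Adj a b)
    (ha : a ∈ vertexFiber T T' f v) (hb : b ∈ vertexFiber T T' f v) :
    ∃ d : T.Dart, d.fst = v ∧ Crosses T T' f d.edge s(a, b) := by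
  rw [vertexFiber_eq_richVerts hT hT3 hf] at ha hb
  exact (exists_crosses_iff hT hT3 hf v ⟨(a, b), hab⟩).2
    ((halfTreeMonotone_meets_vertex v).of_fst_mem_of_snd_mem hT' (d := ⟨(a, b), hab⟩) ha hb)

/-- The vertices of `T'` where the preimage of a half-tree of `T` has a boundary edge. -/
def coboundary (T' : SimpleGraph V') (f : V' → V) (d : T.Dart) : Set V' :=
  {u | ∃ w, T'.Adj u w ∧ f u ∈ halfTree T d ∧ f w ∉ halfTree T d}

/-- The images of the ends of a boundary edge are at most `K` apart and separated by `d`, hence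
close to `d`; fibres are finite. -/
theorem IsCoarseMap.finite_coboundary (hT : T.IsTree) (hlf : ∀ v, (T.neighborSet v).Finite)
    (hf : IsCoarseMap T T' f) (d : T.Dart) : (coboundary T' f d).Finite := by
  obtain ⟨K, hK⟩ := hf.lipschitz
  refine ((finite_ball hT hlf d.snd K).biUnion fun v _ => hf.finite_fiber v).subset ?_
  rintro u ⟨w, huw, hu, hw⟩
  simp only [Set.mem_iUnion]
  refine ⟨f u, ?_, rfl⟩
  have h1 := dist_eq_of_mem_of_notMem hT hu hw
  have h2 := hK u w huw
  change T.dist _ _ ≤ K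
  lia

/-- A half-tree that meets both the preimage of a half-tree and its complement contains a boundary
vertex. -/
theorem exists_mem_coboundary (hT : T.IsTree) {d : T.Dart} {d' : T'.Dart}
    (h : Meets f d d') (h' : Meets f d.symm d') : ∃ u ∈ coboundary T' f d, u ∈ halfTree T' d' := by
  obtain ⟨a, ha, ha'⟩ := h.nonempty
  obtain ⟨b, hb, hb'⟩ := h'.nonempty
  rw [mem_halfTree_symm hT] at hb'
  obtain ⟨p⟩ : (T'.deleteEdges {d'.edge}).Reachable a b :=
    (SimpleGraph.Reachable.symm ha).trans hb
  clear h h' hb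
  induction p with
  | nil => exact absurd ha' hb'
  | @cons a c b hac p ih =>
    by_cases hc : f c ∈ halfTree T d
    · exact ih (SimpleGraph.Reachable.trans ha hac.reachable) hc hb'
    · exact ⟨a, ⟨c, (SimpleGraph.deleteEdges_adj.1 hac).1, ha', hc⟩, ha⟩

/-- A crossing edge has a coboundary vertex on each side, so it lies on a geodesic between two
points of a finite set. -/
theorem IsCoarseMap.finite_edgeFiber (hT : T.IsTree) (hT' : T'.IsTree)
    (hlf : ∀ v, (T.neighborSet v).Finite) (hlf' : ∀ v, (T'.neighborSet v).Finite)
    (hf : IsCoarseMap T T' f) {e : Sym2 V} (he : e ∈ T.edgeSet) :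
    (edgeFiber T T' f e).Finite := by
  induction e with | _ x y
  let d : T.Dart := ⟨(x, y), he⟩
  have hQ := hf.finite_coboundary hT hlf d
  refine (hQ.biUnion fun a _ => hQ.biUnion fun b _ =>
    finite_ball hT' hlf' a (T'.dist a b)).subset ?_
  rintro _ ⟨d', rfl, h⟩
  change Crosses T T' f d.edge d'.edge at h
  obtain ⟨⟨h1, h2⟩, h3, h4⟩ := crosses_edge_iff.1 h
  obtain ⟨a, ha, had⟩ := exists_mem_coboundary hT h1 h2
  obtain ⟨b, hb, hbd⟩ := exists_mem_coboundary hT h3 h4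
  simp only [Set.mem_iUnion]
  refine ⟨a, ha, b, hb, ?_⟩
  have h5 := dist_eq_of_mem_of_notMem hT' had ((mem_halfTree_symm hT').1 hbd)
  change T'.dist d'.snd a ≤ T'.dist a b
  rw [T'.dist_comm (u := a) (v := d'.snd)] at h5
  lia

theorem IsCoarseMap.finite_vertexFiber (hT : T.IsTree) (hT' : T'.IsTree)
    (hlf : ∀ v, (T.neighborSet v).Finite) (hlf' : ∀ v, (T'.neighborSet v).Finite)
    (hf : IsCoarseMap T T' f) (v : V) : (vertexFiber T T' f v).Finite := by
  refine ((hlf v).biUnion (t := fun a => {u | T.Adj v a ∧ u ∈ edgeFiber T T' f s(v, a)})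
    fun a ha => ?_).subset ?_
  · exact (hf.finite_edgeFiber hT hT' hlf hlf' (e := s(v, a)) ha).subset fun u hu => hu.2
  · rintro u ⟨d, rfl, hu⟩
    simp only [Set.mem_iUnion]
    exact ⟨d.snd, d.adj, d.adj, hu⟩

/-- Every edge of `T` crosses an edge of `T'`, unless it induces the same partition as
some edge. -/
theorem IsCoarseMap.edgeFiber_nonempty (hT : T.IsTree) (hT' : T'.IsTree)
    (hlf : ∀ v, (T.neighborSet v).Finite) (hT3' : Trivalent T')
    (hn' : ∀ v, (T'.neighborSet v).Nontrivial) (hf : IsCoarseMap T T' f)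
    (hne : ∀ (d : T.Dart) (d' : T'.Dart), Meets f d d'.symm ∨ Meets f d.symm d')
    {e : Sym2 V} (he : e ∈ T.edgeSet) : (edgeFiber T T' f e).Nonempty := by
  induction e with | _ x y
  let d : T.Dart := ⟨(x, y), he⟩
  by_contra hempty
  have hcross : ∀ d' : T'.Dart, ¬ ((Meets f d d' ∧ Meets f d.symm d') ∧
      Meets f d d'.symm ∧ Meets f d.symm d'.symm) := fun d' h =>
    hempty ⟨d'.snd, d', rfl, (crosses_edge_iff (d := d)).2 h⟩
  have hhalf : ∀ d' : T'.Dart, Meets f d d' ∨ Meets f d.symm d' := by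
    intro d'
    rw [Meets, Meets, ← Set.infinite_union]
    refine (halfTree_infinite hT' hn' d').mono fun u hu => ?_
    by_cases h : f u ∈ halfTree T d
    · exact Or.inl ⟨hu, h⟩
    · exact Or.inr ⟨hu, (mem_halfTree_symm hT).2 h⟩
  have hpre : ∀ (a : T.Dart) (d' : T'.Dart), Meets f a d' ∨ Meets f a d'.symm := by
    intro a d'
    rw [Meets, Meets, ← Set.infinite_union]
    refine (hf.infinite_preimage a).mono fun u hu => ?_
    by_cases h : u ∈ halfTree T' d'
    · exact Or.inl ⟨h, hu⟩
    · exact Or.inr ⟨(mem_halfTree_symm hT').2 h, hu⟩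
  -- `hhalf`, `hpre` and `hne` show that of any two of the four intersections one is infinite, so at
  -- most one fails. Call a half-tree mixed if it meets both `d` and `d.symm`.
  have hone : ∀ d' : T'.Dart, (Meets f d d' ∧ Meets f d.symm d') ∨
      (Meets f d d'.symm ∧ Meets f d.symm d'.symm) := by
    intro d'
    have h1 := hhalf d'
    have h2 := hhalf d'.symm
    have h3 := hpre d d'
    have h4 := hpre d.symm d'
    have h5 := hne d d'
    have h6 := hne d d'.symm
    rw [SimpleGraph.Dart.symm_symm] at h6
    tauto
  -- If neither onward branch is mixed, they are of opposite types. The backward branch, not mixed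
  -- by `hcross`, shares its type with one of them; then neither the other branch nor its complement
  -- is mixed, against `hone`.
  have hnext : ∀ d' : T'.Dart, Meets f d d' ∧ Meets f d.symm d' → ∃ b : T'.Dart,
      b.fst = d'.snd ∧ b.snd ≠ d'.fst ∧ Meets f d b ∧ Meets f d.symm b := by
    intro d' hd'
    obtain ⟨b, c, h⟩ := exists_tripod hT3' d'.symm
    have e1 := h.meets_symm_right (T := T) (f := f) hT'
    have e2 := h.rotate.meets_symm_right (T := T) (f := f) hT'
    have e3 := h.rotate.rotate.meets_symm_right (T := T) (f := f) hT'
    rw [SimpleGraph.Dart.symm_symm] at e1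
    have hb := hone b
    have hc := hone c
    have hd := hcross d'
    have h1 := hhalf d'.symm
    rw [e2, e2] at hb
    rw [e3, e3] at hc
    rw [e1, e1] at hd hd'
    by_cases hbb : Meets f d b ∧ Meets f d.symm b
    · exact ⟨b, h.fst₂, h.ne₁₂.symm, hbb⟩
    · refine ⟨c, h.fst₃, h.ne₁₃.symm, ?_⟩
      clear hcross hhalf hpre hone e1 e2 e3 hne hempty
      grind
  have ⟨o'⟩ := hT'.connected.nonempty
  obtain ⟨a, ha⟩ := (hn' o').nonempty
  obtain ⟨d₀, hd₀⟩ : ∃ d₀ : T'.Dart, Meets f d d₀ ∧ Meets f d.symm d₀ := by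
    rcases hone ⟨(o', a), ha⟩ with h | h
    exacts [⟨_, h⟩, ⟨_, h⟩]
  have hfar : ∀ n, ∃ d' : T'.Dart, (Meets f d d' ∧ Meets f d.symm d') ∧
      d₀.fst ∉ halfTree T' d' ∧ n ≤ T'.dist d'.snd d₀.fst := by
    intro n
    induction n with
    | zero => exact ⟨d₀, hd₀, fst_notMem_halfTree hT' d₀, Nat.zero_le _⟩
    | succ n ih =>
      obtain ⟨d', h1, h2, h3⟩ := ih
      obtain ⟨b, hb1, hb2, hb⟩ := hnext d' h1
      have h4 : b.snd ∈ halfTree T' d' := by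
        by_contra h
        exact hb2 (eq_snd_of_adj_of_mem_of_notMem hT' b.adj
          (hb1 ▸ snd_mem_halfTree d') h).2
      have h5 : d'.fst ∉ halfTree T' b :=
        notMem_halfTree_of_ne hT' (d := d'.symm) hb1.symm (Ne.symm hb2)
          (snd_mem_halfTree d'.symm)
      have h6 : d₀.fst ∉ halfTree T' b := fun h => h2 (halfTree_subset hT' h4 h5 h)
      refine ⟨b, hb, h6, ?_⟩
      rw [dist_snd_of_notMem hT' h6, hb1]
      lia
  -- Mixed half-trees arbitrarily far out each contain a coboundary vertex, which contradicts
  -- finiteness.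
  obtain ⟨K, hK⟩ := ((hf.finite_coboundary hT hlf d).image fun q => T'.dist q d₀.fst).bddAbove
  obtain ⟨d', h1, h2, h3⟩ := hfar (K + 1)
  obtain ⟨q, hq, hqd⟩ := exists_mem_coboundary hT h1.1 h1.2
  have h4 := dist_eq_of_mem_of_notMem hT' hqd h2
  have h5 := dist_snd_of_notMem hT' h2
  have h6 : T'.dist q d₀.fst ≤ K := hK ⟨q, hq, rfl⟩
  lia

end Crossing

end TreeCore

namespace TreeCore

/-! ### Two topological criteria. -/

section Homotopy

/-- A set that can be deformed along segments into a contractible subset is contractible. -/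
theorem contractibleSpace_of_segment {E : Type*} [AddCommGroup E] [Module ℝ E]
    [TopologicalSpace E] [IsTopologicalAddGroup E] [ContinuousSMul ℝ E] {X Y : Set E} (hYX : Y ⊆ X)
    (f : E → E) (hf : ContinuousOn f X) (hXY : Set.MapsTo f X Y)
    (hseg : ∀ p ∈ X, segment ℝ p (f p) ⊆ X) (hY : ContractibleSpace Y) : ContractibleSpace X := by
  rw [contractible_iff_id_nullhomotopic]
  let g : C(X, Y) := ⟨hXY.restrict f X Y, hf.mapsToRestrict hXY⟩
  let i : C(Y, X) := ⟨Set.inclusion hYX, continuous_inclusion hYX⟩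
  have hnull : (i.comp g).Nullhomotopic := by
    have h := ((id_nullhomotopic Y).comp_left g).comp_right i
    simpa using h
  obtain ⟨y, hy⟩ := hnull
  refine ⟨y, ContinuousMap.Homotopic.trans ⟨?_⟩ hy⟩
  have hmem : ∀ q : unitInterval × X,
      AffineMap.lineMap q.2.1 (f q.2.1) (q.1 : ℝ) ∈ X := by
    rintro ⟨t, p⟩
    apply hseg p.1 p.2
    rw [segment_eq_image_lineMap]
    exact ⟨t, t.2, rfl⟩
  exact
    { toFun := fun q => ⟨AffineMap.lineMap q.2.1 (f q.2.1) (q.1 : ℝ), hmem q⟩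
      continuous_toFun := by
        have h1 : Continuous fun q : unitInterval × X => f q.2.1 :=
          (continuousOn_iff_continuous_domRestrict.1 hf).comp continuous_snd
        refine Continuous.subtype_mk ?_ _
        have h2 : Continuous fun q : unitInterval × X => (q.1 : ℝ) :=
          continuous_subtype_val.comp continuous_fst
        have h3 : Continuous fun q : unitInterval × X => (q.2 : E) :=
          continuous_subtype_val.comp continuous_snd
        simp only [AffineMap.lineMap_apply_module]
        exact ((continuous_const.sub h2).smul h3).add (h2.smul h1)
      map_zero_left := fun p => by ext1; simp
      map_one_left := fun p => by ext1; simp [i, g] }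

/-- A nonempty space in which every compact set lies in a simply connected subset is simply
connected. -/
theorem simplyConnectedSpace_of_compact {E : Type*} [TopologicalSpace E] {X : Set E}
    (hne : X.Nonempty)
    (h : ∀ K ⊆ X, IsCompact K → ∃ Y ⊆ X, K ⊆ Y ∧ SimplyConnectedSpace Y) :
    SimplyConnectedSpace X := by
  rw [simply_connected_iff_paths_homotopic']
  constructor
  · refine ⟨hne.to_subtype, fun x y => ?_⟩
    obtain ⟨Y, hYX, hK, hY⟩ := h {x.1, y.1}
      (by rintro _ (rfl | rfl); exacts [x.2, y.2]) ((Set.finite_singleton _).insert _).isCompact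
    have h1 : Joined (⟨x.1, hK (by simp)⟩ : Y) ⟨y.1, hK (by simp)⟩ :=
      PathConnectedSpace.joined _ _
    obtain ⟨p⟩ := h1
    exact ⟨p.map (continuous_inclusion hYX)⟩
  · intro x y p q
    obtain ⟨Y, hYX, hK, hY⟩ := h (Set.range (fun t => (p t).1) ∪ Set.range (fun t => (q t).1))
      (by rintro _ (⟨t, rfl⟩ | ⟨t, rfl⟩); exacts [(p t).2, (q t).2])
      ((isCompact_range (by fun_prop)).union (isCompact_range (by fun_prop)))
    have hp : ∀ t, (p t).1 ∈ Y := fun t => hK (Or.inl ⟨t, rfl⟩)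
    have hq : ∀ t, (q t).1 ∈ Y := fun t => hK (Or.inr ⟨t, rfl⟩)
    let x' : Y := ⟨x.1, by simpa using hp 0⟩
    let y' : Y := ⟨y.1, by simpa using hp 1⟩
    let p' : Path x' y' :=
      { toFun := fun t => ⟨(p t).1, hp t⟩
        continuous_toFun := by fun_prop
        source' := by simp [x']
        target' := by simp [y'] }
    let q' : Path x' y' :=
      { toFun := fun t => ⟨(q t).1, hq t⟩
        continuous_toFun := by fun_prop
        source' := by simp [x']
        target' := by simp [y'] }
    have := (SimplyConnectedSpace.paths_homotopic p' q').map
      (⟨Set.inclusion hYX, continuous_inclusion hYX⟩ : C(Y, X))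
    exact this

end Homotopy

/-! ### Realizations of subtrees and leaf collapses. -/

section Realization

variable {V : Type*} {T : SimpleGraph V}

open Classical in
/-- A vertex as a point of the geometric realization. -/
noncomputable def vertexPoint (v : V) : V → ℝ := Pi.single v 1

@[simp] theorem vertexPoint_self (v : V) : vertexPoint v v = 1 := by simp [vertexPoint]

theorem vertexPoint_of_ne {v w : V} (h : w ≠ v) : vertexPoint v w = 0 := by simp [vertexPoint, h]

theorem closedEdge_eq_segment (a b : V) :
    closedEdge s(a, b) = segment ℝ (vertexPoint a) (vertexPoint b) := by
  rw [closedEdge, ← convexHull_pair]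
  congr 1
  ext x
  simp [vertexPoint, eq_comm]

theorem closedEdge_self (a : V) : closedEdge s(a, a) = {vertexPoint a} := by
  rw [closedEdge_eq_segment, segment_same]

theorem left_mem_closedEdge (a b : V) : vertexPoint a ∈ closedEdge s(a, b) := by
  rw [closedEdge_eq_segment]; exact left_mem_segment _ _ _

theorem right_mem_closedEdge (a b : V) : vertexPoint b ∈ closedEdge s(a, b) := by
  rw [closedEdge_eq_segment]; exact right_mem_segment _ _ _

theorem convex_closedEdge (e : Sym2 V) : Convex ℝ (closedEdge e) := convex_convexHull _ _

theorem mem_closedEdge_iff {a b : V} (hab : a ≠ b) {x : V → ℝ} :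
    x ∈ closedEdge s(a, b) ↔
      0 ≤ x a ∧ 0 ≤ x b ∧ x a + x b = 1 ∧ ∀ v, v ≠ a → v ≠ b → x v = 0 := by
  rw [closedEdge_eq_segment]
  constructor
  · rintro ⟨s, t, hs, ht, hst, rfl⟩
    have h1 : (s • vertexPoint a + t • vertexPoint b : V → ℝ) a = s := by
      simp [vertexPoint_of_ne hab]
    have h2 : (s • vertexPoint a + t • vertexPoint b : V → ℝ) b = t := by
      simp [vertexPoint_of_ne hab.symm]
    rw [h1, h2]
    refine ⟨hs, ht, hst, fun v hva hvb => ?_⟩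
    simp [vertexPoint_of_ne hva, vertexPoint_of_ne hvb]
  · rintro ⟨ha, hb, h1, h0⟩
    refine ⟨x a, x b, ha, hb, h1, ?_⟩
    ext v
    by_cases hva : v = a
    · subst hva; simp [vertexPoint_of_ne hab]
    by_cases hvb : v = b
    · subst hvb; simp [vertexPoint_of_ne hva]
    · simp [vertexPoint_of_ne hva, vertexPoint_of_ne hvb, h0 v hva hvb]

/-- The geometric realization of the subgraph induced on a set of vertices. -/
def hull (T : SimpleGraph V) (S : Set V) : Set (V → ℝ) :=
  {x | ∃ a ∈ S, ∃ b ∈ S, (a = b ∨ T.Adj a b) ∧ x ∈ closedEdge s(a, b)}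

theorem hull_mono {S S' : Set V} (h : S ⊆ S') : hull T S ⊆ hull T S' := by
  rintro x ⟨a, ha, b, hb, hab, hx⟩
  exact ⟨a, h ha, b, h hb, hab, hx⟩

theorem eq_zero_of_mem_closedEdge {a b v : V} {x : V → ℝ} (hx : x ∈ closedEdge s(a, b))
    (hva : v ≠ a) (hvb : v ≠ b) : x v = 0 := by
  by_cases hab : a = b
  · subst hab
    rw [closedEdge_self] at hx
    rw [Set.mem_singleton_iff.1 hx, vertexPoint_of_ne hva]
  · exact ((mem_closedEdge_iff hab).1 hx).2.2.2 v hva hvb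

theorem eq_zero_of_mem_hull {S : Set V} {x : V → ℝ} (hx : x ∈ hull T S) {v : V} (hv : v ∉ S) :
    x v = 0 := by
  obtain ⟨a, ha, b, hb, -, hx⟩ := hx
  exact eq_zero_of_mem_closedEdge hx (fun h => hv (h ▸ ha)) (fun h => hv (h ▸ hb))

/-- Move the mass at `u` to `p`. -/
noncomputable def push (u p : V) (x : V → ℝ) : V → ℝ := x + x u • (vertexPoint p - vertexPoint u)

theorem continuous_push (u p : V) : Continuous (push u p) := by
  unfold push; fun_prop

theorem push_of_eq_zero {u p : V} {x : V → ℝ} (h : x u = 0) : push u p x = x := by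
  simp [push, h]

theorem push_of_mem_closedEdge {u p : V} (hup : u ≠ p) {x : V → ℝ} (h : x ∈ closedEdge s(u, p)) :
    push u p x = vertexPoint p := by
  obtain ⟨h1, h2, h3, h4⟩ := (mem_closedEdge_iff hup).1 h
  ext v
  by_cases hvu : v = u
  · subst hvu; simp [push, vertexPoint_of_ne hup]
  by_cases hvp : v = p
  · subst hvp; simp [push, vertexPoint_of_ne hup.symm]; linarith
  · simp [push, vertexPoint_of_ne hvu, vertexPoint_of_ne hvp, h4 v hvu hvp]

/-- Pushing a leaf `u` of `R` to its neighbour retracts the realization of `R`. -/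
theorem hull_push {R : Set V} {u p : V} (hup : T.Adj u p)
    (huniq : ∀ w ∈ R, T.Adj u w → w = p) {y : V → ℝ} (hy : y ∈ hull T R) :
    (push u p y = y ∧ y ∈ hull T (R \ {u})) ∨
      (y ∈ closedEdge s(u, p) ∧ push u p y = vertexPoint p) := by
  by_cases hyu : y ∈ closedEdge s(u, p)
  · exact Or.inr ⟨hyu, push_of_mem_closedEdge hup.ne hyu⟩
  left
  obtain ⟨a, ha, b, hb, hab, hy⟩ := hy
  have hau : a ≠ u := by
    rintro rfl
    rcases hab with rfl | hab
    · rw [closedEdge_self] at hy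
      exact hyu (Set.mem_singleton_iff.1 hy ▸ left_mem_closedEdge _ _)
    · rw [huniq b hb hab] at hy
      exact hyu hy
  have hbu : b ≠ u := by
    rintro rfl
    rcases hab with rfl | hab
    · exact hau rfl
    · rw [huniq a ha hab.symm, Sym2.eq_swap] at hy
      exact hyu hy
  exact ⟨push_of_eq_zero (eq_zero_of_mem_closedEdge hy hau.symm hbu.symm),
    a, ⟨ha, hau⟩, b, ⟨hb, hbu⟩, hab, hy⟩

theorem vertexPoint_mem_hull {S : Set V} {v : V} (hv : v ∈ S) : vertexPoint v ∈ hull T S :=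
  ⟨v, hv, v, hv, Or.inl rfl, left_mem_closedEdge _ _⟩

/-- The realization of a finite subtree is contractible. -/
theorem contractibleSpace_prod_hull (hT : T.IsTree) {W : Type*} (z : W → ℝ) {R : Set V}
    (hR : R.Finite) (hne : R.Nonempty) (hconv : TreeConvex T R) :
    ContractibleSpace (({z} : Set (W → ℝ)) ×ˢ hull T R : Set ((W → ℝ) × (V → ℝ))) := by
  -- Leaves are pushed in one at a time. The inert factor `{z}` makes the result apply to the fibre
  -- over a vertex.
  induction hn : R.ncard generalizing R with
  | zero =>
    rw [Set.ncard_eq_zero hR] at hn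
    exact absurd hn hne.ne_empty
  | succ n ih =>
    obtain ⟨o, ho⟩ := hne
    by_cases hsub : R ⊆ {o}
    · obtain rfl : R = {o} := hsub.antisymm (Set.singleton_subset_iff.2 ho)
      have : hull T {o} = {vertexPoint o} := by
        ext x
        constructor
        · rintro ⟨a, rfl, b, rfl, -, hx⟩
          rwa [closedEdge_self] at hx
        · rintro rfl
          exact vertexPoint_mem_hull rfl
      rw [this, Set.singleton_prod_singleton]
      infer_instance
    obtain ⟨u, hu, p, hp, hup, huniq, hconv'⟩ := hconv.exists_leaf hT hR
      (treeConvex_singleton hT o) (Set.singleton_nonempty o) (Set.singleton_subset_iff.2 ho) hsub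
    have hpu : p ∈ R \ {u} := ⟨hp, hup.ne'⟩
    refine contractibleSpace_of_segment (Y := {z} ×ˢ hull T (R \ {u}))
      (Set.prod_mono le_rfl (hull_mono Set.sdiff_subset)) (fun q => (q.1, push u p q.2))
      (Continuous.continuousOn (continuous_fst.prodMk ((continuous_push u p).comp continuous_snd)))
      ?_ ?_ (ih (hR.subset Set.sdiff_subset) ⟨p, hpu⟩ hconv' ?_)
    · rintro ⟨x, y⟩ ⟨hx, hy⟩
      refine ⟨hx, ?_⟩
      rcases hull_push hup huniq hy with ⟨h1, h2⟩ | ⟨h1, h2⟩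
      · change push u p y ∈ _; rwa [h1]
      · change push u p y ∈ _; rw [h2]; exact vertexPoint_mem_hull hpu
    · rintro ⟨x, y⟩ ⟨hx, hy⟩
      refine Set.Subset.trans (Prod.segment_subset _ _) (Set.prod_mono ?_ ?_)
      · simpa using hx
      · rcases hull_push hup huniq hy with ⟨h1, h2⟩ | ⟨h1, h2⟩
        · change segment ℝ y (push u p y) ⊆ _
          rw [h1, segment_same]
          simpa using hy
        · change segment ℝ y (push u p y) ⊆ _
          rw [h2]
          refine ((convex_closedEdge _).segment_subset h1 (right_mem_closedEdge _ _)).trans ?_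
          exact fun w hw => ⟨u, hu.1, p, hp, Or.inr hup, hw⟩
    · rw [Set.ncard_sdiff_singleton_of_mem hu.1, hn]; rfl

end Realization

end TreeCore

namespace TreeCore

/-! ### Contractibility over finite subtrees and simple connectivity of the core. -/

section CrossCore

variable {V V' : Type*} {f : V' → V} {T' : SimpleGraph V'} {T : SimpleGraph V}

/-- The union of the products of the edges of `T` with the subtrees of crossing edges. -/
def crossCore (T : SimpleGraph V) (T' : SimpleGraph V') (f : V' → V) :
    Set ((V → ℝ) × (V' → ℝ)) :=
  {p | ∃ d : T.Dart, p.1 ∈ closedEdge d.edge ∧ p.2 ∈ hull T' (edgeFiber T T' f d.edge)}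

theorem edgeFiber_subset_vertexFiber (d : T.Dart) :
    edgeFiber T T' f d.edge ⊆ vertexFiber T T' f d.fst :=
  fun _ hu => ⟨d, rfl, hu⟩

theorem mem_edgeFiber_of_crosses {e : Sym2 V} {d' : T'.Dart} (h : Crosses T T' f e d'.edge) :
    d'.fst ∈ edgeFiber T T' f e ∧ d'.snd ∈ edgeFiber T T' f e :=
  ⟨⟨d'.symm, rfl, by rwa [SimpleGraph.Dart.edge_symm]⟩, d', rfl, h⟩

theorem mem_crossCore_iff (hT' : T'.IsTree) {p : (V → ℝ) × (V' → ℝ)} :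
    p ∈ crossCore T T' f ↔ ∃ e ∈ T.edgeSet, ∃ e' ∈ T'.edgeSet, Crosses T T' f e e' ∧
      p.1 ∈ closedEdge e ∧ p.2 ∈ closedEdge e' := by
  constructor
  · rintro ⟨d, h1, a, ha, b, hb, hab, h2⟩
    refine ⟨d.edge, d.edge_mem, ?_⟩
    rcases hab with rfl | hab
    · obtain ⟨d', rfl, h⟩ := ha
      rw [closedEdge_self] at h2
      exact ⟨d'.edge, d'.edge_mem, h, h1, Set.mem_singleton_iff.1 h2 ▸ right_mem_closedEdge _ _⟩
    · exact ⟨s(a, b), hab, crosses_of_mem_edgeFiber hT' d.edge_mem hab ha hb, h1, h2⟩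
  · rintro ⟨e, he, e', hab, h, h1, h2⟩
    induction e with | _ x y
    induction e' with | _ a b
    obtain ⟨h3, h4⟩ := mem_edgeFiber_of_crosses (d' := ⟨(a, b), hab⟩) h
    exact ⟨⟨(x, y), he⟩, h1, a, h3, b, h4, Or.inr hab, h2⟩

/-- The fibre of the core over a vertex. -/
theorem vertexPoint_mem_crossCore (hT : T.IsTree) (hT' : T'.IsTree) (hT3 : Trivalent T)
    (hf : ∀ v, {u | f u = v}.Finite) {v : V} {y : V' → ℝ}
    (hy : y ∈ hull T' (vertexFiber T T' f v)) : (vertexPoint v, y) ∈ crossCore T T' f := by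
  obtain ⟨a, ha, b, hb, hab, hy⟩ := hy
  rcases hab with rfl | hab
  · obtain ⟨d, rfl, h⟩ := ha
    exact ⟨d, left_mem_closedEdge _ _, a, h, a, h, Or.inl rfl, hy⟩
  · obtain ⟨d, rfl, h⟩ := exists_crosses_of_mem_vertexFiber hT hT' hT3 hf hab ha hb
    obtain ⟨h3, h4⟩ := mem_edgeFiber_of_crosses (d' := ⟨(a, b), hab⟩) h
    exact ⟨d, left_mem_closedEdge _ _, a, h3, b, h4, Or.inr hab, hy⟩

theorem exists_dart_of_mem_crossCore {p : (V → ℝ) × (V' → ℝ)} (hp : p ∈ crossCore T T' f) {w : V}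
    (hw : p.1 w ≠ 0) : ∃ d : T.Dart, d.fst = w ∧ p.1 ∈ closedEdge d.edge ∧
      p.2 ∈ hull T' (edgeFiber T T' f d.edge) := by
  obtain ⟨d, h1, h2⟩ := hp
  by_cases hd : d.fst = w
  · exact ⟨d, hd, h1, h2⟩
  by_cases hd' : d.snd = w
  · refine ⟨d.symm, hd', ?_, ?_⟩ <;> rwa [SimpleGraph.Dart.edge_symm]
  · exact absurd (eq_zero_of_mem_closedEdge (a := d.fst) (b := d.snd) h1 (Ne.symm hd)
      (Ne.symm hd')) hw

theorem eq_vertexPoint_of_mem_closedEdge {d : T.Dart} {x : V → ℝ} (hx : x ∈ closedEdge d.edge)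
    (h : x d.snd = 0) : x = vertexPoint d.fst := by
  have h' := push_of_mem_closedEdge d.adj.ne' (x := x)
    (by rw [Sym2.eq_swap]; exact hx)
  rwa [push_of_eq_zero h] at h'

theorem fst_eq_vertexPoint_of_mem_crossCore {p : (V → ℝ) × (V' → ℝ)}
    (hp : p ∈ crossCore T T' f) {w : V} (hw : p.1 w = 1) : p.1 = vertexPoint w := by
  obtain ⟨d, rfl, h1, -⟩ := exists_dart_of_mem_crossCore hp (w := w) (by rw [hw]; norm_num)
  apply eq_vertexPoint_of_mem_closedEdge h1
  have h2 := ((mem_closedEdge_iff d.adj.ne).1 h1).2.2.1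
  change p.1 d.fst + p.1 d.snd = 1 at h2
  linarith

theorem snd_mem_hull_of_mem_crossCore {p : (V → ℝ) × (V' → ℝ)} (hp : p ∈ crossCore T T' f) {v : V}
    (hv : p.1 v ≠ 0) : p.2 ∈ hull T' (vertexFiber T T' f v) := by
  obtain ⟨d, rfl, -, h⟩ := exists_dart_of_mem_crossCore hp hv
  exact hull_mono (edgeFiber_subset_vertexFiber d) h

/-- The part of the core over the subtree spanned by `S`. -/
def coreOver (T : SimpleGraph V) (T' : SimpleGraph V') (f : V' → V) (S : Set V) :
    Set ((V → ℝ) × (V' → ℝ)) :=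
  {p | p ∈ crossCore T T' f ∧ ∀ v, v ∉ S → p.1 v = 0}

/-- The part of the core over the subtree spanned by `S`, with the fibre over the leaf `w`
restricted to the subtree spanned by `R`. -/
def coreOverShrunk (T : SimpleGraph V) (T' : SimpleGraph V') (f : V' → V) (S : Set V) (w : V)
    (R : Set V') : Set ((V → ℝ) × (V' → ℝ)) :=
  {p | p ∈ coreOver T T' f S ∧ (p.1 w = 1 → p.2 ∈ hull T' R)}

theorem coreOver_singleton (hT : T.IsTree) (hT' : T'.IsTree) (hT3 : Trivalent T)
    (hf : ∀ v, {u | f u = v}.Finite) (o : V) :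
    coreOver T T' f {o} = {vertexPoint o} ×ˢ hull T' (vertexFiber T T' f o) := by
  ext ⟨x, y⟩
  constructor
  · rintro ⟨hp, h0⟩
    have hxo : x o ≠ 0 := by
      intro hxo
      obtain ⟨d, h1, -⟩ := hp
      have h := (mem_closedEdge_iff d.adj.ne).1 h1
      have hx : ∀ v, x v = 0 := fun v => by
        by_cases hv : v = o
        · rw [hv, hxo]
        · exact h0 v hv
      have := h.2.2.1
      simp only [hx] at this
      norm_num at this
    refine ⟨?_, snd_mem_hull_of_mem_crossCore hp hxo⟩
    obtain ⟨d, rfl, h1, -⟩ := exists_dart_of_mem_crossCore hp hxo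
    exact eq_vertexPoint_of_mem_closedEdge h1 (h0 _ d.adj.ne')
  · rintro ⟨rfl, hy⟩
    exact ⟨vertexPoint_mem_crossCore hT hT' hT3 hf hy, fun v hv => vertexPoint_of_ne hv⟩

/-- Over a leaf edge `{w, v}` the core is a product. -/
theorem mem_of_leaf {S : Set V} {w v : V} (hwv : T.Adj w v)
    (huniq : ∀ a ∈ S, T.Adj w a → a = v) {p : (V → ℝ) × (V' → ℝ)}
    (hp : p ∈ coreOver T T' f S) (hw : p.1 w ≠ 0) (hw1 : p.1 w ≠ 1) :
    p.1 ∈ closedEdge s(w, v) ∧ p.2 ∈ hull T' (edgeFiber T T' f s(w, v)) := by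
  obtain ⟨d, rfl, h1, h2⟩ := exists_dart_of_mem_crossCore hp.1 hw
  have hd : d.snd = v := by
    apply huniq _ _ d.adj
    by_contra h
    rw [eq_vertexPoint_of_mem_closedEdge h1 (hp.2 _ h)] at hw1
    exact hw1 (vertexPoint_self _)
  subst hd
  exact ⟨h1, h2⟩

/-- Once the fibre over `w` is only the edge fibre, the part over `{w, v}` is a product, and pushing
`w` to `v` collapses it. -/
theorem contractibleSpace_coreOverShrunk_edge {S : Set V} {w v : V} (hwS : w ∈ S)
    (hvS : v ∈ S) (hwv : T.Adj w v) (huniq : ∀ a ∈ S, T.Adj w a → a = v)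
    (h : ContractibleSpace (coreOver T T' f (S \ {w}))) :
    ContractibleSpace (coreOverShrunk T T' f S w (edgeFiber T T' f s(w, v))) := by
  let d : T.Dart := ⟨(w, v), hwv⟩
  have hcases : ∀ p ∈ coreOverShrunk T T' f S w (edgeFiber T T' f s(w, v)),
      p.1 w = 0 ∨ (p.1 ∈ closedEdge s(w, v) ∧ p.2 ∈ hull T' (edgeFiber T T' f s(w, v))) := by
    intro p hp
    by_cases h0 : p.1 w = 0
    · exact Or.inl h0
    right
    by_cases h1 : p.1 w = 1
    · refine ⟨?_, hp.2 h1⟩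
      rw [fst_eq_vertexPoint_of_mem_crossCore hp.1.1 h1]
      exact left_mem_closedEdge _ _
    · exact mem_of_leaf hwv huniq hp.1 h0 h1
  have hslice : ∀ x ∈ closedEdge s(w, v), ∀ y ∈ hull T' (edgeFiber T T' f s(w, v)),
      (x, y) ∈ coreOverShrunk T T' f S w (edgeFiber T T' f s(w, v)) := by
    intro x hx y hy
    refine ⟨⟨⟨d, hx, hy⟩, fun u hu => ?_⟩, fun _ => hy⟩
    exact eq_zero_of_mem_closedEdge hx (fun h => hu (h ▸ hwS)) (fun h => hu (h ▸ hvS))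
  refine contractibleSpace_of_segment (Y := coreOver T T' f (S \ {w})) ?_
    (fun q => (push w v q.1, q.2))
    (Continuous.continuousOn (((continuous_push w v).comp continuous_fst).prodMk continuous_snd))
    ?_ ?_ h
  · intro p hp
    refine ⟨⟨hp.1, fun u hu => hp.2 u fun h => hu h.1⟩, fun h1 => ?_⟩
    rw [hp.2 w (by simp)] at h1
    norm_num at h1
  · intro p hp
    beta_reduce
    rcases hcases p hp with h0 | ⟨h1, h2⟩
    · rw [push_of_eq_zero h0]
      refine ⟨hp.1.1, fun u hu => ?_⟩
      by_cases huw : u = w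
      · rw [huw]; exact h0
      · exact hp.1.2 u fun h => hu ⟨h, huw⟩
    · rw [push_of_mem_closedEdge hwv.ne h1]
      exact ⟨⟨d, right_mem_closedEdge _ _, h2⟩, fun u hu =>
        vertexPoint_of_ne fun h => hu (h ▸ ⟨hvS, hwv.ne'⟩)⟩
  · intro p hp
    rcases hcases p hp with h0 | ⟨h1, h2⟩
    · rw [push_of_eq_zero h0, segment_same]
      simpa using hp
    · rw [push_of_mem_closedEdge hwv.ne h1]
      intro q hq
      obtain ⟨hq1, hq2⟩ := Prod.segment_subset _ _ hq
      rw [segment_same] at hq2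
      have h3 := (convex_closedEdge _).segment_subset h1 (right_mem_closedEdge _ _) hq1
      have := hslice q.1 h3 p.2 h2
      rw [← Set.mem_singleton_iff.1 hq2] at this
      exact this

/-- Induction on `R`, from the edge fibre up to the vertex fibre: a leaf of `R` outside the edge
fibre is attached only over `w` and can be pushed in there. -/
theorem contractibleSpace_coreOverShrunk (hT : T.IsTree) (hT' : T'.IsTree) (hT3 : Trivalent T)
    (hf : ∀ v, {u | f u = v}.Finite) {S : Set V} {w v : V} (hwS : w ∈ S)
    (hvS : v ∈ S) (hwv : T.Adj w v) (huniq : ∀ a ∈ S, T.Adj w a → a = v)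
    (hne : (edgeFiber T T' f s(w, v)).Nonempty)
    (h : ContractibleSpace (coreOver T T' f (S \ {w}))) {R : Set V'} (hR : R.Finite)
    (hconv : TreeConvex T' R) (hR1 : edgeFiber T T' f s(w, v) ⊆ R)
    (hR2 : R ⊆ vertexFiber T T' f w) :
    ContractibleSpace (coreOverShrunk T T' f S w R) := by
  classical
  induction hn : R.ncard generalizing R with
  | zero =>
    rw [Set.ncard_eq_zero hR] at hn
    exact absurd (Set.subset_eq_empty hR1 hn) hne.ne_empty
  | succ n ih =>
    by_cases hsub : R ⊆ edgeFiber T T' f s(w, v)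
    · obtain rfl := hsub.antisymm hR1
      exact contractibleSpace_coreOverShrunk_edge hwS hvS hwv huniq h
    obtain ⟨u, hu, p, hp, hup, hup', hconv'⟩ := hconv.exists_leaf hT' hR
      (treeConvex_edgeFiber hT' (T := T) (e := s(w, v)) hwv) hne hR1 hsub
    have hpu : p ∈ R \ {u} := ⟨hp, hup.ne'⟩
    have hmem : ∀ R' ⊆ R, ∀ y ∈ hull T' R', (vertexPoint w, y) ∈ coreOverShrunk T T' f S w R' :=
      fun R' hR' y hy => ⟨⟨vertexPoint_mem_crossCore hT hT' hT3 hf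
        (hull_mono (hR'.trans hR2) hy), fun a ha => vertexPoint_of_ne fun h => ha (h ▸ hwS)⟩,
        fun _ => hy⟩
    refine contractibleSpace_of_segment (Y := coreOverShrunk T T' f S w (R \ {u})) ?_
      (fun q => if q.1 w = 1 then (q.1, push u p q.2) else q) ?_ ?_ ?_
      (ih (hR.subset Set.sdiff_subset) hconv' (fun a ha => ⟨hR1 ha, fun h => hu.2 (h ▸ ha)⟩)
        (Set.sdiff_subset.trans hR2) ?_)
    · exact fun q hq => ⟨hq.1, fun h1 => hull_mono Set.sdiff_subset (hq.2 h1)⟩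
    -- The two closed sets cover the space: over the interior of the leaf edge the second coordinate
    -- lies in the edge fibre, which misses `u`. On the overlap `push` is the identity.
    · have hA : IsClosed {q : (V → ℝ) × (V' → ℝ) | q.1 w = 1} :=
        isClosed_eq (by fun_prop) continuous_const
      have hB : IsClosed {q : (V → ℝ) × (V' → ℝ) | q.1 w = 0 ∨ q.2 u = 0} :=
        (isClosed_eq (by fun_prop) continuous_const).union
          (isClosed_eq (by fun_prop) continuous_const)
      have hcA : ContinuousOn (fun q : (V → ℝ) × (V' → ℝ) =>
          if q.1 w = 1 then (q.1, push u p q.2) else q) {q | q.1 w = 1} :=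
        (Continuous.continuousOn (continuous_fst.prodMk
          ((continuous_push u p).comp continuous_snd))).congr fun q hq => if_pos hq
      have hcB : ContinuousOn (fun q : (V → ℝ) × (V' → ℝ) =>
          if q.1 w = 1 then (q.1, push u p q.2) else q) {q | q.1 w = 0 ∨ q.2 u = 0} := by
        refine continuousOn_id.congr fun q hq => ?_
        rcases hq with hq | hq
        · exact if_neg (by rw [hq]; norm_num)
        · simp [push_of_eq_zero hq]
      refine (hcA.union_of_isClosed hcB hA hB).mono fun q hq => ?_
      by_cases h1 : q.1 w = 1
      · exact Or.inl h1
      by_cases h0 : q.1 w = 0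
      · exact Or.inr (Or.inl h0)
      · exact Or.inr (Or.inr (eq_zero_of_mem_hull (mem_of_leaf hwv huniq hq.1 h0 h1).2 hu.2))
    · intro q hq
      beta_reduce
      by_cases h1 : q.1 w = 1
      · have hq1 := fst_eq_vertexPoint_of_mem_crossCore hq.1.1 h1
        rw [if_pos h1, hq1]
        refine hmem _ Set.sdiff_subset _ ?_
        rcases hull_push hup hup' (hq.2 h1) with ⟨h2, h3⟩ | ⟨h2, h3⟩
        · rwa [h2]
        · rw [h3]; exact vertexPoint_mem_hull hpu
      · rw [if_neg h1]
        exact ⟨hq.1, fun h => absurd h h1⟩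
    · intro q hq
      by_cases h1 : q.1 w = 1
      · have hq1 := fst_eq_vertexPoint_of_mem_crossCore hq.1.1 h1
        rw [if_pos h1]
        intro z hz
        obtain ⟨hz1, hz2⟩ := Prod.segment_subset _ _ hz
        rw [segment_same] at hz1
        have hz1' : z.1 = vertexPoint w := (Set.mem_singleton_iff.1 hz1).trans hq1
        have hz3 : z.2 ∈ hull T' R := by
          rcases hull_push hup hup' (hq.2 h1) with ⟨h2, h3⟩ | ⟨h2, h3⟩
          · rw [h2, segment_same] at hz2
            rw [Set.mem_singleton_iff.1 hz2]
            exact hq.2 h1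
          · rw [h3] at hz2
            exact ⟨u, hu.1, p, hp, Or.inr hup,
              (convex_closedEdge _).segment_subset h2 (right_mem_closedEdge _ _) hz2⟩
        have := hmem R le_rfl z.2 hz3
        rw [← hz1'] at this
        exact this
      · rw [if_neg h1, segment_same]
        simpa using hq
    · rw [Set.ncard_sdiff_singleton_of_mem hu.1, hn]; rfl

theorem contractibleSpace_coreOver (hT : T.IsTree) (hT' : T'.IsTree) (hT3 : Trivalent T)
    (hf : ∀ v, {u | f u = v}.Finite) (hfin : ∀ v, (vertexFiber T T' f v).Finite)
    (hne : ∀ e ∈ T.edgeSet, (edgeFiber T T' f e).Nonempty) {S : Set V} (hS : S.Finite)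
    (hSne : S.Nonempty) (hconv : TreeConvex T S) : ContractibleSpace (coreOver T T' f S) := by
  have hnbr : ∀ v, ∃ a, T.Adj v a := fun v => by
    have h : (T.neighborSet v).Nonempty := by
      rw [← Set.ncard_pos (Set.finite_of_ncard_ne_zero (by rw [hT3 v]; lia)), hT3 v]; lia
    exact h
  induction hn : S.ncard generalizing S with
  | zero =>
    rw [Set.ncard_eq_zero hS] at hn
    exact absurd hn hSne.ne_empty
  | succ n ih =>
    obtain ⟨o, ho⟩ := hSne
    by_cases hsub : S ⊆ {o}
    · obtain rfl : S = {o} := hsub.antisymm (Set.singleton_subset_iff.2 ho)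
      rw [coreOver_singleton hT hT' hT3 hf]
      refine contractibleSpace_prod_hull hT' _ (hfin o) ?_
        (treeConvex_vertexFiber hT hT' hT3 hf o)
      obtain ⟨a, ha⟩ := hnbr o
      exact (hne s(o, a) ha).mono (edgeFiber_subset_vertexFiber ⟨(o, a), ha⟩)
    obtain ⟨w, hw, v, hv, hwv, huniq, hconv'⟩ := hconv.exists_leaf hT hS
      (treeConvex_singleton hT o) (Set.singleton_nonempty o) (Set.singleton_subset_iff.2 ho) hsub
    have h := ih (hS.subset Set.sdiff_subset) ⟨v, hv, hwv.ne'⟩ hconv'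
      (by rw [Set.ncard_sdiff_singleton_of_mem hw.1, hn]; rfl)
    have h' := contractibleSpace_coreOverShrunk hT hT' hT3 hf hw.1 hv hwv huniq (hne s(w, v) hwv) h
      (hfin w) (treeConvex_vertexFiber hT hT' hT3 hf w)
      (edgeFiber_subset_vertexFiber ⟨(w, v), hwv⟩) le_rfl
    have : coreOverShrunk T T' f S w (vertexFiber T T' f w) = coreOver T T' f S := by
      ext p
      refine ⟨fun hp => hp.1, fun hp => ⟨hp, fun h1 => ?_⟩⟩
      exact snd_mem_hull_of_mem_crossCore hp.1 (by rw [h1]; norm_num)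
    rwa [this] at h'

theorem simplyConnectedSpace_crossCore (hT : T.IsTree) (hT' : T'.IsTree) (hT3 : Trivalent T)
    (hlf : ∀ v, (T.neighborSet v).Finite)
    (hf : ∀ v, {u | f u = v}.Finite) (hfin : ∀ v, (vertexFiber T T' f v).Finite)
    (hne : ∀ e ∈ T.edgeSet, (edgeFiber T T' f e).Nonempty) :
    SimplyConnectedSpace (crossCore T T' f) := by
  have ⟨o⟩ := hT.connected.nonempty
  have hcontr : ∀ n : ℕ, ContractibleSpace (coreOver T T' f {u | T.dist u o ≤ n}) := fun n =>
    contractibleSpace_coreOver hT hT' hT3 hf hfin hne (finite_ball hT hlf o n)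
      ⟨o, by simp⟩ (treeConvex_ball hT o n)
  apply simplyConnectedSpace_of_compact
  · have := hcontr 0
    obtain ⟨p, hp⟩ := (inferInstance : Nonempty (coreOver T T' f {u | T.dist u o ≤ 0}))
    exact ⟨p, hp.1⟩
  intro K hKC hK
  obtain ⟨t, ht⟩ := hK.elim_finite_subcover
    (fun v : V => {p : (V → ℝ) × (V' → ℝ) | 0 < p.1 v})
    (fun v => isOpen_lt continuous_const (by fun_prop)) (fun p hp => by
      obtain ⟨d, h1, -⟩ := hKC hp
      obtain ⟨h2, h3, h4, -⟩ := (mem_closedEdge_iff d.adj.ne).1 h1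
      simp only [Set.mem_iUnion]
      rcases h2.lt_or_eq with h | h
      · exact ⟨_, h⟩
      · refine ⟨d.snd, ?_⟩
        change 0 < p.1 d.snd
        change 0 = p.1 d.fst at h
        change p.1 d.fst + p.1 d.snd = 1 at h4
        linarith)
  obtain ⟨n, hn⟩ := (t.finite_toSet.image fun v => T.dist v o).bddAbove
  -- A point of `K` has positive mass at a vertex within `n` of `o`; the other end of its edge may
  -- be one step farther.
  refine ⟨coreOver T T' f {u | T.dist u o ≤ n + 1}, fun p hp => hp.1, fun p hp => ⟨hKC hp, ?_⟩,
    have := hcontr (n + 1); inferInstance⟩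
  intro u hu
  obtain ⟨v, hvt, hv⟩ := Set.mem_iUnion₂.1 (ht hp)
  obtain ⟨d, rfl, h1, -⟩ := exists_dart_of_mem_crossCore (hKC hp) (ne_of_gt hv)
  have h2 : T.dist d.fst o ≤ n := hn ⟨_, hvt, rfl⟩
  have hu' : ¬ T.dist u o ≤ n + 1 := hu
  apply eq_zero_of_mem_closedEdge (a := d.fst) (b := d.snd) h1
  · rintro rfl; lia
  · rintro rfl
    rcases dist_adj hT o d.adj with h | h <;> lia

end CrossCore

end TreeCore

namespace TreeCore

/-! ### The diagonal action is a covering action. -/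

section Equivariance

variable {V V' : Type*} {Γ : Type*} [Group Γ] {T : SimpleGraph V} {T' : SimpleGraph V'}

theorem map_mem_halfTree_iff (hT : T.IsTree) (φ : T ≃g T) {d : T.Dart} {w : V} :
    φ w ∈ halfTree T (φ.toHom.mapDart d) ↔ w ∈ halfTree T d := by
  rw [mem_halfTree_iff hT, mem_halfTree_iff hT]
  change T.dist (φ d.snd) (φ w) < T.dist (φ d.fst) (φ w) ↔ _
  rw [dist_map_iso, dist_map_iso]

theorem mapDart_mapDart_symm (φ : T ≃g T) (d : T.Dart) :
    φ.toHom.mapDart (φ.symm.toHom.mapDart d) = d :=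
  SimpleGraph.Dart.ext _ _ (Prod.ext (φ.apply_symm_apply _) (φ.apply_symm_apply _))

/-- Translating an orbit section gives another one. -/
theorem IsOrbitSection.translate {ρ' : Γ →* (T' ≃g T')} {c : V' → Γ} (hc : IsOrbitSection ρ' c)
    (γ : Γ) : IsOrbitSection ρ' fun u => γ * c (ρ' γ⁻¹ u) := by
  obtain ⟨s, hs, h⟩ := hc
  refine ⟨s, hs, fun u => ?_⟩
  obtain ⟨b, hb, hbu⟩ := h (ρ' γ⁻¹ u)
  refine ⟨b, hb, ?_⟩
  rw [map_mul_apply, hbu, ← map_mul_apply, mul_inv_cancel, map_one, RelIso.one_apply]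

theorem meets_translate_iff (hT : T.IsTree) (hT' : T'.IsTree) {ρ : Γ →* (T ≃g T)}
    {ρ' : Γ →* (T' ≃g T')} {c : V' → Γ} (v₀ : V) (γ : Γ) (d : T.Dart) (d' : T'.Dart) :
    Meets (fun u => ρ (γ * c (ρ' γ⁻¹ u)) v₀) ((ρ γ).toHom.mapDart d) ((ρ' γ).toHom.mapDart d') ↔
      Meets (fun u => ρ (c u) v₀) d d' := by
  have : {u | u ∈ halfTree T' ((ρ' γ).toHom.mapDart d') ∧
      ρ (γ * c (ρ' γ⁻¹ u)) v₀ ∈ halfTree T ((ρ γ).toHom.mapDart d)} =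
      ρ' γ '' {u | u ∈ halfTree T' d' ∧ ρ (c u) v₀ ∈ halfTree T d} := by
    ext u
    obtain ⟨u, rfl⟩ := (ρ' γ).surjective u
    rw [(ρ' γ).injective.mem_set_image]
    simp only [Set.mem_ofPred_eq, map_mem_halfTree_iff hT', map_mul_apply ρ,
      map_mem_halfTree_iff hT, ← map_mul_apply ρ', inv_mul_cancel, map_one, RelIso.one_apply]
  rw [Meets, Meets, this, Set.infinite_image_iff (ρ' γ).injective.injOn]

/-- Since `nonNested_iff` holds for every orbit section, `c` can be used for the original edges and
its translate for their images. -/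
theorem NonNested.translate (hT : T.IsTree) (hT' : T'.IsTree)
    (hf : ∀ v, (T.neighborSet v).Finite) (hf' : ∀ v, (T'.neighborSet v).Finite)
    {ρ : Γ →* (T ≃g T)} {ρ' : Γ →* (T' ≃g T')}
    (hρ : IsGeometricAction ρ) (hρ' : IsGeometricAction ρ') {e : Sym2 V} {e' : Sym2 V'}
    (h : NonNested (edgePartition T e) (edgePartition' ρ ρ' e'))
    (γ : Γ) : NonNested (edgePartition T (e.map (ρ γ))) (edgePartition' ρ ρ' (e'.map (ρ' γ))) := by
  have ⟨v₀⟩ := hT.connected.nonempty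
  obtain ⟨c, hc⟩ := hρ'.exists_isOrbitSection
  rw [nonNested_iff hT hT' hf hf' hρ hρ' hc v₀] at h
  rw [nonNested_iff hT hT' hf hf' hρ hρ' (hc.translate γ) v₀]
  intro a b ha hb
  rw [← mapDart_mapDart_symm (ρ γ) a] at ha ⊢
  rw [← mapDart_mapDart_symm (ρ' γ) b] at hb ⊢
  rw [meets_translate_iff hT hT']
  exact h _ _ (Sym2.map.injective (ρ γ).injective ha) (Sym2.map.injective (ρ' γ).injective hb)

theorem act_apply_map (ρ : Γ →* (T ≃g T)) (γ : Γ) (x : V → ℝ) (v : V) :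
    act ρ γ x (ρ γ v) = x v := by
  rw [act, ← map_mul_apply, inv_mul_cancel, map_one, RelIso.one_apply]

theorem act_vertexPoint (ρ : Γ →* (T ≃g T)) (γ : Γ) (v : V) :
    act ρ γ (vertexPoint v) = vertexPoint (ρ γ v) := by
  ext w
  obtain ⟨w, rfl⟩ := (ρ γ).surjective w
  rw [act_apply_map]
  by_cases hwv : w = v
  · rw [hwv, vertexPoint_self, vertexPoint_self]
  · rw [vertexPoint_of_ne hwv, vertexPoint_of_ne fun h => hwv ((ρ γ).injective h)]

theorem act_mem_closedEdge (ρ : Γ →* (T ≃g T)) (γ : Γ) {e : Sym2 V} {x : V → ℝ}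
    (hx : x ∈ closedEdge e) : act ρ γ x ∈ closedEdge (e.map (ρ γ)) := by
  induction e with | _ a b
  rw [Sym2.map_mk, closedEdge_eq_segment]
  rw [closedEdge_eq_segment] at hx
  obtain ⟨s, t, hs, ht, hst, rfl⟩ := hx
  refine ⟨s, t, hs, ht, hst, ?_⟩
  rw [← act_vertexPoint, ← act_vertexPoint]
  rfl

theorem continuous_act (ρ : Γ →* (T ≃g T)) (γ : Γ) : Continuous (act ρ γ) := by
  unfold act; fun_prop

theorem act_one (ρ : Γ →* (T ≃g T)) (x : V → ℝ) : act ρ 1 x = x := by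
  ext v; simp [act]

theorem act_mul (ρ : Γ →* (T ≃g T)) (γ δ : Γ) (x : V → ℝ) :
    act ρ (γ * δ) x = act ρ γ (act ρ δ x) := by
  ext v; simp [act]

/-- The diagonal action on the core. -/
@[reducible] def coreMulAction (hT : T.IsTree) (hT' : T'.IsTree)
    (hf : ∀ v, (T.neighborSet v).Finite) (hf' : ∀ v, (T'.neighborSet v).Finite)
    {ρ : Γ →* (T ≃g T)} {ρ' : Γ →* (T' ≃g T')}
    (hρ : IsGeometricAction ρ) (hρ' : IsGeometricAction ρ') : MulAction Γ (core ρ ρ') where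
  smul γ p := ⟨(act ρ γ p.1.1, act ρ' γ p.1.2), by
    obtain ⟨e, he, e', he', h, h1, h2⟩ := p.2
    refine ⟨e.map (ρ γ), ?_, e'.map (ρ' γ), ?_, h.translate hT hT' hf hf' hρ hρ' γ,
      act_mem_closedEdge ρ γ h1, act_mem_closedEdge ρ' γ h2⟩
    · induction e with | _ a b
      exact (ρ γ).map_adj_iff.2 he
    · induction e' with | _ a b
      exact (ρ' γ).map_adj_iff.2 he'⟩
  one_smul p := Subtype.ext (Prod.ext (act_one ρ _) (act_one ρ' _))
  mul_smul γ δ p := Subtype.ext (Prod.ext (act_mul ρ γ δ _) (act_mul ρ' γ δ _))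

theorem mem_of_pos_of_mem_closedEdge {a b v : V} {x : V → ℝ} (hx : x ∈ closedEdge s(a, b))
    (hv : 0 < x v) : v = a ∨ v = b := by
  by_contra! h
  exact hv.ne' (eq_zero_of_mem_closedEdge hx h.1 h.2)

/-- A free action of a torsion-free group on the vertices of a tree is a covering action on the
realization. -/
theorem exists_disjoint_nhd [IsMulTorsionFree Γ] {ρ : Γ →* (T ≃g T)} (hρ : IsGeometricAction ρ)
    {a b : V} (hab : a ≠ b) {x : V → ℝ} (hx : x ∈ closedEdge s(a, b)) :
    ∃ U : Set (V → ℝ), IsOpen U ∧ x ∈ U ∧ ∀ γ : Γ, ∀ y ∈ U, act ρ γ y ∈ U →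
      (∃ a' b', a' ≠ b' ∧ act ρ γ y ∈ closedEdge s(a', b')) → γ = 1 := by
  obtain ⟨h1, h2, h3, -⟩ := (mem_closedEdge_iff hab).1 hx
  -- A point of an edge has mass above `1 / 2` at no more than one vertex, so `γ` must fix `v`.
  have large : ∀ v, 1 / 2 < x v → ∃ U : Set (V → ℝ), IsOpen U ∧ x ∈ U ∧ ∀ γ : Γ, ∀ y ∈ U,
      act ρ γ y ∈ U → (∃ a' b', a' ≠ b' ∧ act ρ γ y ∈ closedEdge s(a', b')) → γ = 1 := by
    intro v hv
    refine ⟨{z | 1 / 2 < z v}, isOpen_lt continuous_const (continuous_apply v), hv, ?_⟩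
    rintro γ y hy hy' ⟨a', b', hab', he⟩
    have hy1 : 1 / 2 < act ρ γ y (ρ γ v) := by rw [act_apply_map]; exact hy
    have hy2 : 1 / 2 < act ρ γ y v := hy'
    obtain ⟨-, -, hs, -⟩ := (mem_closedEdge_iff hab').1 he
    apply hρ.free γ v
    rcases mem_of_pos_of_mem_closedEdge he (by linarith : 0 < act ρ γ y (ρ γ v)) with h4 | h4 <;>
    rcases mem_of_pos_of_mem_closedEdge he (by linarith : 0 < act ρ γ y v) with h5 | h5
    · rw [h4, h5]
    · rw [h4] at hy1; rw [h5] at hy2; linarith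
    · rw [h4] at hy1; rw [h5] at hy2; linarith
    · rw [h4, h5]
  rcases lt_trichotomy (x a) (1 / 2) with h | h | h
  · exact large b (by linarith)
  -- At the midpoint the open edge serves as neighbourhood. An element preserving it might swap its
  -- ends, but then its square fixes `a`, and torsion-freeness applies.
  · refine ⟨{z | 0 < z a ∧ 0 < z b}, (isOpen_lt continuous_const (continuous_apply a)).inter
      (isOpen_lt continuous_const (continuous_apply b)), ⟨by linarith, by linarith⟩, ?_⟩
    rintro γ y hy hy' ⟨a', b', hab', he⟩
    have key : ∀ v, 0 < act ρ γ y v → v = a ∨ v = b := by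
      intro v hv
      have ha := mem_of_pos_of_mem_closedEdge he hy'.1
      have hb := mem_of_pos_of_mem_closedEdge he hy'.2
      have hv := mem_of_pos_of_mem_closedEdge he hv
      grind
    have hga := key (ρ γ a) (by rw [act_apply_map]; exact hy.1)
    have hgb := key (ρ γ b) (by rw [act_apply_map]; exact hy.2)
    have hinj : ρ γ a ≠ ρ γ b := fun h => hab ((ρ γ).injective h)
    rcases hga with hga | hga
    · exact hρ.free γ a hga
    · have hgb' : ρ γ b = a := by grind
      have hsq : γ ^ 2 = 1 := hρ.free _ a (by rw [pow_two, map_mul_apply, hga, hgb'])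
      exact (pow_eq_one_iff_left two_ne_zero).1 hsq
  · exact large a h

/-- The neighbourhoods are pulled back from the first factor alone. -/
theorem isQuotientCoveringMap_core [IsMulTorsionFree Γ] (hT : T.IsTree) (hT' : T'.IsTree)
    (hf : ∀ v, (T.neighborSet v).Finite) (hf' : ∀ v, (T'.neighborSet v).Finite)
    {ρ : Γ →* (T ≃g T)} {ρ' : Γ →* (T' ≃g T')}
    (hρ : IsGeometricAction ρ) (hρ' : IsGeometricAction ρ') :
    letI := coreMulAction hT hT' hf hf' hρ hρ'
    IsQuotientCoveringMap (Quotient.mk (coreOrbitRel ρ ρ')) Γ := by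
  let := coreMulAction hT hT' hf hf' hρ hρ'
  have hcont : ContinuousConstSMul Γ (core ρ ρ') := ⟨fun γ => Continuous.subtype_mk
    (((continuous_act ρ γ).comp (continuous_fst.comp continuous_subtype_val)).prodMk
      ((continuous_act ρ' γ).comp (continuous_snd.comp continuous_subtype_val))) _⟩
  refine { isQuotientMap_quot_mk with
    continuous_const_smul := hcont.continuous_const_smul
    apply_eq_iff_mem_orbit := ?_
    disjoint := ?_ }
  · intro p q
    rw [Quotient.eq]
    constructor
    · intro h
      obtain ⟨γ, h⟩ := (coreOrbitRel ρ ρ').symm h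
      exact ⟨γ, Subtype.ext h.symm⟩
    · rintro ⟨γ, h⟩
      exact (coreOrbitRel ρ ρ').symm ⟨γ, (congrArg Subtype.val h).symm⟩
  · intro p
    have hedge : ∀ q : core ρ ρ', ∃ a b, a ≠ b ∧ q.1.1 ∈ closedEdge s(a, b) := by
      intro q
      obtain ⟨e, he, -, -, -, h1, -⟩ := q.2
      induction e with | _ a b
      exact ⟨a, b, SimpleGraph.Adj.ne he, h1⟩
    obtain ⟨a, b, hab, hp⟩ := hedge p
    obtain ⟨U, hU, hpU, h⟩ := exists_disjoint_nhd hρ hab hp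
    refine ⟨{q | q.1.1 ∈ U}, (hU.preimage
      (continuous_fst.comp continuous_subtype_val)).mem_nhds hpU, ?_⟩
    rintro γ ⟨_, ⟨q, hq, rfl⟩, hq'⟩
    exact h γ q.1.1 hq hq' (hedge (γ • q))

end Equivariance

end TreeCore

theorem mainTheorem6 {V V' : Type*} (g : ℕ) (T : SimpleGraph V) (T' : SimpleGraph V')
    (hT : T.IsTree) (hT' : T'.IsTree)
    (hT3 : TreeCore.Trivalent T) (hT'3 : TreeCore.Trivalent T')
    (ρ : FreeGroup (Fin g) →* (T ≃g T)) (ρ' : FreeGroup (Fin g) →* (T' ≃g T'))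
    (hρ : TreeCore.IsGeometricAction ρ) (hρ' : TreeCore.IsGeometricAction ρ')
    (hne : ∀ e ∈ T.edgeSet, ∀ e' ∈ T'.edgeSet,
      TreeCore.edgePartition T e ≠ TreeCore.edgePartition' ρ ρ' e') :
    SimplyConnectedSpace (TreeCore.core ρ ρ') ∧
      ∀ x : TreeCore.Delta ρ ρ',
        Nonempty (FundamentalGroup (TreeCore.Delta ρ ρ') x ≃* FreeGroup (Fin g)) := by
  have hf : ∀ v, (T.neighborSet v).Finite := fun v =>
    Set.finite_of_ncard_ne_zero (by rw [hT3 v]; lia)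
  have hf' : ∀ v, (T'.neighborSet v).Finite := fun v =>
    Set.finite_of_ncard_ne_zero (by rw [hT'3 v]; lia)
  have hn : ∀ v, (T.neighborSet v).Nontrivial := fun v =>
    have := (hf v).to_subtype
    Set.one_lt_ncard_iff_nontrivial.1 (by rw [hT3 v]; lia)
  have hn' : ∀ v, (T'.neighborSet v).Nontrivial := fun v =>
    have := (hf' v).to_subtype
    Set.one_lt_ncard_iff_nontrivial.1 (by rw [hT'3 v]; lia)
  have ⟨v₀⟩ := hT.connected.nonempty
  obtain ⟨c, hc⟩ := hρ'.exists_isOrbitSection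
  have hcoarse := TreeCore.isCoarseMap_orbitSection hT hT' hf hn hf' hn' hρ hρ' hc v₀
  have hcore : TreeCore.core ρ ρ' = TreeCore.crossCore T T' (fun u => ρ (c u) v₀) := by
    ext p
    rw [TreeCore.mem_crossCore_iff hT']
    simp only [TreeCore.core, TreeCore.nonNested_iff hT hT' hf hf' hρ hρ' hc v₀,
      Set.mem_ofPred_eq]
  have hsc : SimplyConnectedSpace (TreeCore.core ρ ρ') := by
    rw [hcore]
    refine TreeCore.simplyConnectedSpace_crossCore hT hT' hT3 hf hcoarse.finite_fiber
      (hcoarse.finite_vertexFiber hT hT' hf hf')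
      fun e he => hcoarse.edgeFiber_nonempty hT hT' hf hT'3 hn' (fun d d' => ?_) he
    by_contra! h
    exact hne _ d.edge_mem _ d'.edge_mem
      (TreeCore.edgePartition_eq_of_not_meets hT hT' hf hf' hρ hρ' hc v₀ h.1 h.2)
  refine ⟨hsc, fun x => ?_⟩
  let := TreeCore.coreMulAction hT hT' hf hf' hρ hρ'
  have hcov := TreeCore.isQuotientCoveringMap_core hT hT' hf hf' hρ hρ'
  obtain ⟨p, hp⟩ := hcov.surjective x
  -- The deck group appears as the opposite group; inversion turns it back into the group itself.
  exact ⟨(hcov.fundamentalGroupEquiv ⟨p, hp⟩).trans (MulEquiv.inv' _).symm⟩
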